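/- We work in the word RAM model. A program is a fixed finite list of instructions operating on finitely many registers and on a random access memory; each instruction (loading a constant, an arithmetic or bitwise operation on two registers, a load or store at an address held in a register, a conditional jump) costs one step. Numbers are integers. We say that a problem is solved in time $O(T(n))$ if there is a single program such that for every $d \in \mathbb{N}$ there are constants $C, k$ (depending on $d$) such that, for every $n \ge 1$ and every instance of size $n$ whose numbers have absolute value at most $n^d$, the program halts with a correct output after at most $C \cdot T(n)$ steps, and all numbers occurring in registers and memory during the computation have absolute value at most $C n^k$ (i.e. words have $O(\log n)$ bits). **$(\min,+)$-Convolution.** Given integer sequences $(a_i)_{1 \le i \le n}$ and $(b_i)_{1 \le i \le n}$ (an instance of size $n$), compute $c_i = \min_{1 \le j \le i} (a_j + b_{i-j+1})$ for all $1 \le i \le n$. **Min Bisection on edge-weighted paths.** Given a path $P$ on $n$ vertices (an instance of size $n$) with positive integer edge weights, listed in the order in which the edges appear along the path, compute a bisection of minimum weight, where a bisection is a partition of the vertex set of $P$ into two sets $A, B$ with $-1 \le |A| - |B| \le 1$, and its weight is the total weight of the edges between $A$ and $B$. **Theorem.** Unless there is a $\delta > 0$ such that $(\min,+)$-Convolution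 can be solved in time $O(n^{2-\delta})$, there is no $\varepsilon > 0$ such that Min Bisection on edge-weighted paths can be solved in time $O(n^{2-\varepsilon})$. -/

import Mathlib

namespace WordRAM

/-- The binary operations of the machine.  Division and remainder are Euclidean, with `x / 0 = 0`
and `x % 0 = x`; the bitwise operations act on two's complement representations, and a shift by a
negative amount is a shift by `0`. -/
inductive Op
  | add | sub | mul | div | mod | and | or | xor | shl | shr

/-- The result of an operation. -/
def Op.eval : Op → ℤ → ℤ → ℤ
  | .add, x, y => x + y
  | .sub, x, y => x - y
  | .mul, x, y => x * y
  | .div, x, y => x / y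
  | .mod, x, y => x % y
  | .and, x, y => Int.land x y
  | .or, x, y => Int.lor x y
  | .xor, x, y => Int.xor x y
  | .shl, x, y => x <<< y.toNat
  | .shr, x, y => x >>> y.toNat

/-- The instructions of a random access machine.  Registers are named by natural numbers (a program
mentions only finitely many of them), memory cells are addressed by integers. -/
inductive Instr
  /-- `reg[dst] := k` -/
  | const (dst : ℕ) (k : ℤ)
  /-- `reg[dst] := reg[x] op reg[y]` -/
  | op (o : Op) (dst x y : ℕ)
  /-- `reg[dst] := mem[reg[addr]]` -/
  | load (dst addr : ℕ)
  /-- `mem[reg[addr]] := reg[src]` -/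
  | store (addr src : ℕ)
  /-- if `reg[x] > 0`, jump to the instruction number `target`; otherwise go on. -/
  | jumpPos (x target : ℕ)

/-- A program: a finite list of instructions, numbered from `0`. -/
abbrev Program := List Instr

/-- A configuration: program counter, registers and memory. -/
structure Config where
  pc : ℕ
  reg : ℕ → ℤ
  mem : ℤ → ℤ

/-- The effect of one instruction. -/
def Instr.exec (c : Config) : Instr → Config
  | .const dst k => ⟨c.pc + 1, Function.update c.reg dst k, c.mem⟩
  | .op o dst x y => ⟨c.pc + 1, Function.update c.reg dst (o.eval (c.reg x) (c.reg y)), c.mem⟩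
  | .load dst addr => ⟨c.pc + 1, Function.update c.reg dst (c.mem (c.reg addr)), c.mem⟩
  | .store addr src => ⟨c.pc + 1, c.reg, Function.update c.mem (c.reg addr) (c.reg src)⟩
  | .jumpPos x target => ⟨if 0 < c.reg x then target else c.pc + 1, c.reg, c.mem⟩

/-- The machine has halted when the program counter has left the program. -/
def Halted (P : Program) (c : Config) : Prop := P.length ≤ c.pc

/-- One step of the computation; a halted machine does not move. -/
def step (P : Program) (c : Config) : Config :=
  match P[c.pc]? with
  | some i => i.exec c
  | none => c

/-- The initial configuration for an input of size `n`: register `0` holds `n`, all other registers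
are `0`, and the memory holds the input. -/
def initial (n : ℕ) (input : ℤ → ℤ) : Config :=
  ⟨0, fun r => if r = 0 then (n : ℤ) else 0, input⟩

/-- All registers and memory cells hold integers of absolute value at most `B`. -/
def Config.Bounded (c : Config) (B : ℕ) : Prop :=
  (∀ r, |c.reg r| ≤ (B : ℤ)) ∧ ∀ x, |c.mem x| ≤ (B : ℤ)

/-- The memory holding the list `l` in the cells `0, …, l.length - 1`, and `0` elsewhere. -/
def memOfList (l : List ℤ) : ℤ → ℤ :=
  fun x => if 0 ≤ x then l.getD x.toNat 0 else 0

/-- A computational problem on integer data: for every size `n` a type of instances, their encoding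
as a list of integers, and the relation "the memory contents `m` is a correct output for the
instance". -/
structure Problem where
  Inst : ℕ → Type
  encode : ∀ {n : ℕ}, Inst n → List ℤ
  Correct : ∀ {n : ℕ}, Inst n → (ℤ → ℤ) → Prop

/-- `Prob` can be solved in time `O(T n)` in the word RAM model with words of `O(log n)` bits, on
integers of `O(log n)` bits.  That is, there is one program such that for every exponent `d`, with
constants that depend only on `d`, on every instance of size `n ≥ 1` whose numbers have absolute
value at most `n ^ d`, the program halts within `C * T n` steps with a correct output, and at no
time during the computation does a register or memory cell hold a number of absolute value more
than `C * n ^ k`. -/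
def Problem.SolvableInTime (Prob : Problem) (T : ℕ → ℝ) : Prop :=
  ∃ P : Program, ∀ d : ℕ, ∃ C k : ℕ, ∀ n : ℕ, 1 ≤ n → ∀ I : Prob.Inst n,
    (∀ x ∈ Prob.encode I, |x| ≤ (n : ℤ) ^ d) →
    ∃ t : ℕ, (t : ℝ) ≤ C * T n ∧
      Halted P ((step P)^[t] (initial n (memOfList (Prob.encode I)))) ∧
      Prob.Correct I ((step P)^[t] (initial n (memOfList (Prob.encode I)))).mem ∧
      ∀ s ≤ t, ((step P)^[s] (initial n (memOfList (Prob.encode I)))).Bounded (C * n ^ k)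

end WordRAM

/-- `(min, +)`-Convolution: given integer sequences `a` and `b` of length `n` (indexed from `0`),
compute `c k = min {a i + b j | i + j = k}` for all `k < n`.  The input is the list
`a 0, …, a (n-1), b 0, …, b (n-1)`; at the end the memory cell `k` has to hold `c k`. -/
def minPlusConvolution : WordRAM.Problem where
  Inst n := (Fin n → ℤ) × (Fin n → ℤ)
  encode I := List.ofFn I.1 ++ List.ofFn I.2
  Correct {n} I m := ∀ k : Fin n,
    IsLeast {x : ℤ | ∃ i j : Fin n, (i : ℕ) + (j : ℕ) = (k : ℕ) ∧ x = I.1 i + I.2 j} (m (k : ℕ))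

section Bisection

variable {V : Type*} [Fintype V] [DecidableEq V]

open Classical in
/-- The total weight `w(A, B)` of the edges of `G` between `A` and `B = V \ A`. -/
noncomputable def cutWeight (G : SimpleGraph V) (w : Sym2 V → ℤ) (A : Finset V) : ℤ :=
  ∑ e ∈ G.edgeFinset with ∃ u ∈ A, ∃ v ∈ Aᶜ, e = s(u, v), w e

/-- The cut `(A, V \ A)` is a bisection: `-1 ≤ |A| - |V \ A| ≤ 1`. -/
def IsBisection (A : Finset V) : Prop :=
  -1 ≤ (A.card : ℤ) - (Aᶜ.card : ℤ) ∧ (A.card : ℤ) - (Aᶜ.card : ℤ) ≤ 1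

/-- The cut `(A, V \ A)` is a bisection of minimum weight of the edge-weighted graph `(G, w)`. -/
def IsMinBisection (G : SimpleGraph V) (w : Sym2 V → ℤ) (A : Finset V) : Prop :=
  IsBisection A ∧ ∀ A' : Finset V, IsBisection A' → cutWeight G w A ≤ cutWeight G w A'

end Bisection

/-- Min Bisection on edge-weighted paths: given the path on the vertices `0, …, n-1` with positive
integer edge weights, compute a bisection of minimum weight.  The input is the list of the weights
of the edges `{0, 1}, {1, 2}, …, {n-2, n-1}`; at the end the memory cell `v` has to hold `1` if the
vertex `v` is on the first side of the computed bisection, and `0` if it is on the other side. -/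
def minBisectionOnPaths : WordRAM.Problem where
  Inst n := {w : Sym2 (Fin n) → ℤ // ∀ e ∈ (SimpleGraph.pathGraph n).edgeSet, 0 < w e}
  encode {n} I := List.ofFn fun i : Fin (n - 1) =>
    I.1 s(⟨(i : ℕ), by omega⟩, ⟨(i : ℕ) + 1, by omega⟩)
  Correct {n} I m := ∃ A : Finset (Fin n), IsMinBisection (SimpleGraph.pathGraph n) I.1 A ∧
    ∀ v : Fin n, m ((v : ℕ) : ℤ) = if v ∈ A then 1 else 0

/-!
# Minimum bisections of paths and `(min, +)`-convolution

A program for minimum bisections of paths is turned into a program for `(min, +)`-convolution. The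
sequences are split into blocks of length about `√n`. A minimum bisection of a path with `O(√n)`
vertices yields the minimum of `a i + b j - c (i + j)` over a pair of blocks, so that a simultaneous
binary search for all entries of the convolution needs `O(n)` calls in each of `O(log n)` rounds.

Every call runs in a slice of the memory of its own, a residue class of addresses. The registers of
the called program are shifted by `40`; registers below `30` hold persistent values and parameters,
those from `30` to `39` are scratch.
-/

namespace WordRAM

/-! ### Executions -/

/-- `Q` leads from `c` to `c'` in `t` steps, through configurations bounded by `B`. -/
def Reach (Q : Program) (B : ℕ) (c c' : Config) (t : ℕ) : Prop :=
  (step Q)^[t] c = c' ∧ ∀ u ≤ t, ((step Q)^[u] c).Bounded B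

theorem Reach.refl {Q : Program} {B : ℕ} {c : Config} (h : c.Bounded B) : Reach Q B c c 0 :=
  ⟨rfl, fun u hu => by obtain rfl : u = 0 := by omega
                       exact h⟩

theorem Reach.trans {Q : Program} {B : ℕ} {c c' c'' : Config} {t t' : ℕ}
    (h : Reach Q B c c' t) (h' : Reach Q B c' c'' t') : Reach Q B c c'' (t + t') := by
  refine ⟨by rw [add_comm, Function.iterate_add_apply, h.1, h'.1], fun u hu => ?_⟩
  rcases le_total u t with hut | hut
  · exact h.2 u hut
  · obtain ⟨w, rfl⟩ := Nat.exists_eq_add_of_le hut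
    rw [add_comm, Function.iterate_add_apply, h.1]
    exact h'.2 w (by omega)

theorem Reach.single {Q : Program} {B : ℕ} {c c' : Config} {i : Instr}
    (hi : Q[c.pc]? = some i) (hc : i.exec c = c')
    (h : c.Bounded B) (h' : c'.Bounded B) : Reach Q B c c' 1 := by
  have hs : step Q c = c' := by simp [step, hi, hc]
  refine ⟨by simpa using hs, fun u hu => ?_⟩
  interval_cases u
  · exact h
  · simpa [hs] using h'

/-! ### Relocatable code -/

/-- The part of a configuration that does not depend on the position of the code. -/
structure Store where
  reg : ℕ → ℤ
  mem : ℤ → ℤ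

/-- The configuration with a given program counter. -/
def Store.at (s : Store) (pc : ℕ) : Config := ⟨pc, s.reg, s.mem⟩

/-- All registers and memory cells hold integers of absolute value at most `B`. -/
def Store.Bounded (s : Store) (B : ℕ) : Prop :=
  (∀ r, |s.reg r| ≤ (B : ℤ)) ∧ ∀ x, |s.mem x| ≤ (B : ℤ)

/-- The store with a new value in a register. -/
def Store.setReg (s : Store) (r : ℕ) (v : ℤ) : Store := ⟨Function.update s.reg r v, s.mem⟩

/-- The store with a new value in a memory cell. -/
def Store.setMem (s : Store) (x v : ℤ) : Store := ⟨s.reg, Function.update s.mem x v⟩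

theorem Store.reg_setReg (s : Store) (r q : ℕ) (v : ℤ) :
    (s.setReg r v).reg q = if q = r then v else s.reg q := by
  simp [Store.setReg, Function.update_apply]

@[simp] theorem Store.mem_setReg (s : Store) (r : ℕ) (v : ℤ) : (s.setReg r v).mem = s.mem := rfl

@[simp] theorem Store.reg_setMem (s : Store) (x v : ℤ) : (s.setMem x v).reg = s.reg := rfl

theorem Store.mem_setMem (s : Store) (x y v : ℤ) :
    (s.setMem x v).mem y = if y = x then v else s.mem y := by
  simp [Store.setMem, Function.update_apply]

theorem Store.Bounded.setReg {s : Store} {B : ℕ} (h : s.Bounded B) (r : ℕ) {v : ℤ}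
    (hv : |v| ≤ (B : ℤ)) : (s.setReg r v).Bounded B := by
  refine ⟨fun q => ?_, h.2⟩
  rw [Store.reg_setReg]
  split_ifs
  exacts [hv, h.1 q]

theorem Store.Bounded.setMem {s : Store} {B : ℕ} (h : s.Bounded B) (x : ℤ) {v : ℤ}
    (hv : |v| ≤ (B : ℤ)) : (s.setMem x v).Bounded B := by
  refine ⟨h.1, fun y => ?_⟩
  rw [Store.mem_setMem]
  split_ifs
  exacts [hv, h.2 y]

/-- The program `Q` contains the code `l` from position `b` on. -/
def HasCode (Q : Program) (b : ℕ) (l : List Instr) : Prop :=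
  ∀ i < l.length, Q[b + i]? = l[i]?

theorem HasCode.left {Q : Program} {b : ℕ} {l l' : List Instr} (h : HasCode Q b (l ++ l')) :
    HasCode Q b l := fun i hi => by
  rw [h i (by simp; omega), List.getElem?_append_left hi]

theorem HasCode.right {Q : Program} {b : ℕ} {l l' : List Instr} (h : HasCode Q b (l ++ l')) :
    HasCode Q (b + l.length) l' := fun i hi => by
  rw [add_assoc, h (l.length + i) (by simp; omega), List.getElem?_append_right (by omega)]
  simp

theorem HasCode.head {Q : Program} {b : ℕ} {x : Instr} {l : List Instr}
    (h : HasCode Q b (x :: l)) : Q[b]? = some x := by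
  simpa using h 0 (by simp)

theorem HasCode.tail {Q : Program} {b : ℕ} {x : Instr} {l : List Instr}
    (h : HasCode Q b (x :: l)) : HasCode Q (b + 1) l := fun i hi => by
  rw [add_assoc, add_comm 1 i, h (i + 1) (by simpa using hi)]
  simp

theorem hasCode_self (Q : Program) : HasCode Q 0 Q := fun i _ => by simp

/-- Relocatable code: the instructions may depend on the position of the first one, their number
does not. -/
structure Frag where
  len : ℕ
  code : ℕ → List Instr
  length_code : ∀ b, (code b).length = len

/-- Wherever the code is placed, it takes the store `s` to `s'` in `t` steps, through
configurations bounded by `B`, and ends just behind itself. -/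
def Frag.Runs (F : Frag) (B : ℕ) (s s' : Store) (t : ℕ) : Prop :=
  ∀ (Q : Program) (b : ℕ), HasCode Q b (F.code b) → Reach Q B (s.at b) (s'.at (b + F.len)) t

/-- From the store `s`, the code reaches a store that satisfies `post` within `T` steps. -/
def Frag.Ensures (F : Frag) (B T : ℕ) (post : Store → Prop) (s : Store) : Prop :=
  ∃ s' t, t ≤ T ∧ post s' ∧ s'.Bounded B ∧ F.Runs B s s' t

theorem Frag.Ensures.mono {F : Frag} {B T T' : ℕ} {post post' : Store → Prop} {s : Store}
    (h : F.Ensures B T post s) (hT : T ≤ T')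
    (hp : ∀ s', s'.Bounded B → post s' → post' s') : F.Ensures B T' post' s := by
  obtain ⟨s', t, ht, hs, hb, hr⟩ := h
  exact ⟨s', t, ht.trans hT, hp _ hb hs, hb, hr⟩

/-- Sequential composition. -/
def Frag.seq (F F' : Frag) : Frag where
  len := F.len + F'.len
  code b := F.code b ++ F'.code (b + F.len)
  length_code b := by simp [F.length_code, F'.length_code]

theorem Frag.Ensures.seq {F F' : Frag} {B T T' : ℕ} {mid post : Store → Prop} {s : Store}
    (h : F.Ensures B T mid s)
    (h' : ∀ s', s'.Bounded B → mid s' → F'.Ensures B T' post s') :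
    (F.seq F').Ensures B (T + T') post s := by
  obtain ⟨s', t, ht, hs, hb, hr⟩ := h
  obtain ⟨s'', t', ht', hs', hb', hr'⟩ := h' s' hb hs
  refine ⟨s'', t + t', by omega, hs', hb', fun Q b hQ => ?_⟩
  have h1 := hr Q b hQ.left
  have h2 := hr' Q (b + F.len) (by simpa [F.length_code] using hQ.right)
  rw [show b + (F.seq F').len = b + F.len + F'.len by simp [Frag.seq]; ring]
  exact h1.trans h2

/-! ### Straight-line code -/

/-- The instructions other than jumps. -/
inductive Stmt
  | const (dst : ℕ) (k : ℤ)
  | op (o : Op) (dst x y : ℕ)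
  | load (dst addr : ℕ)
  | store (addr src : ℕ)

/-- The statement as an instruction of the machine. -/
def Stmt.toInstr : Stmt → Instr
  | .const dst k => .const dst k
  | .op o dst x y => .op o dst x y
  | .load dst addr => .load dst addr
  | .store addr src => .store addr src

/-- The weakest precondition of straight-line code, which includes that all computed values are
bounded by `B`. -/
def pre (B : ℕ) (post : Store → Prop) : List Stmt → Store → Prop
  | [], s => post s
  | .const dst k :: l, s => |k| ≤ (B : ℤ) ∧ pre B post l (s.setReg dst k)
  | .op o dst x y :: l, s => |o.eval (s.reg x) (s.reg y)| ≤ (B : ℤ) ∧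
      pre B post l (s.setReg dst (o.eval (s.reg x) (s.reg y)))
  | .load dst addr :: l, s => pre B post l (s.setReg dst (s.mem (s.reg addr)))
  | .store addr src :: l, s => pre B post l (s.setMem (s.reg addr) (s.reg src))

/-- Straight-line code. -/
def Frag.basic (l : List Stmt) : Frag where
  len := l.length
  code _ := l.map Stmt.toInstr
  length_code _ := by simp

theorem Frag.Runs.cons {x : Stmt} {l : List Stmt} {B t : ℕ} {s s₁ s' : Store}
    (hs : s.Bounded B) (h₁ : s₁.Bounded B)
    (hx : ∀ b, x.toInstr.exec (s.at b) = s₁.at (b + 1))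
    (h : (Frag.basic l).Runs B s₁ s' t) : (Frag.basic (x :: l)).Runs B s s' (1 + t) := by
  intro Q b hQ
  have e : Reach Q B (s.at b) (s₁.at (b + 1)) 1 :=
    Reach.single (i := x.toInstr) (by simpa [Store.at] using HasCode.head hQ) (hx b) hs h₁
  have := h Q (b + 1) (HasCode.tail hQ)
  rw [show b + (Frag.basic (x :: l)).len = b + 1 + (Frag.basic l).len by simp [Frag.basic]; ring]
  exact e.trans this

theorem Frag.Ensures.basic {l : List Stmt} {B T : ℕ} {post : Store → Prop} {s : Store}
    (hs : s.Bounded B) (hT : l.length ≤ T) (h : pre B post l s) :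
    (Frag.basic l).Ensures B T post s := by
  suffices H : (Frag.basic l).Ensures B l.length post s from H.mono hT fun _ _ h => h
  clear hT T
  induction l generalizing s with
  | nil => exact ⟨s, 0, le_rfl, h, hs, fun Q b _ => Reach.refl hs⟩
  | cons x l ih =>
    suffices H : ∃ s₁ : Store, s₁.Bounded B ∧ pre B post l s₁ ∧
        ∀ b, x.toInstr.exec (s.at b) = s₁.at (b + 1) by
      obtain ⟨s₁, h₁, h₂, h₃⟩ := H
      obtain ⟨s', t, ht, hp, hb, hr⟩ := ih h₁ h₂
      exact ⟨s', 1 + t, by simp; omega, hp, hb, hr.cons hs h₁ h₃⟩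
    cases x with
    | const dst k => exact ⟨_, hs.setReg dst h.1, h.2, fun b => rfl⟩
    | op o dst x y => exact ⟨_, hs.setReg dst h.1, h.2, fun b => rfl⟩
    | load dst addr => exact ⟨_, hs.setReg dst (hs.2 _), h, fun b => rfl⟩
    | store addr src => exact ⟨_, hs.setMem _ (hs.1 _), h, fun b => rfl⟩

/-! ### Loops -/

/-- `while reg[x] > 0 do F`; register `39` serves for the unconditional jump to the test. -/
def Frag.while (x : ℕ) (F : Frag) : Frag where
  len := F.len + 3
  code b := .const 39 1 :: .jumpPos 39 (b + 2 + F.len) ::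
    (F.code (b + 2) ++ [.jumpPos x (b + 2)])
  length_code b := by simp [F.length_code]

theorem Frag.Ensures.while {x : ℕ} {F : Frag} {B T : ℕ} (inv : ℕ → Store → Prop)
    (hB : 1 ≤ B) (hF : ∀ k s, s.Bounded B → inv k s → 0 < s.reg x →
      F.Ensures B T (fun s' => ∃ k' < k, inv k' s') s)
    {K : ℕ} {s : Store} (hs : s.Bounded B) (h : inv K (s.setReg 39 1)) :
    (F.while x).Ensures B (K * (T + 1) + 3)
      (fun s' => ¬ 0 < s'.reg x ∧ ∃ k ≤ K, inv k s') s := by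
  have key : ∀ K : ℕ, ∀ s : Store, s.Bounded B → inv K s → ∃ s' t, t ≤ K * (T + 1) + 1 ∧
      (¬ 0 < s'.reg x ∧ ∃ k ≤ K, inv k s') ∧ s'.Bounded B ∧
      ∀ (Q : Program) (b : ℕ), HasCode Q b ((F.while x).code b) →
        Reach Q B (s.at (b + 2 + F.len)) (s'.at (b + (F.while x).len)) t := by
    intro K
    induction K using Nat.strong_induction_on with
    | _ K ih =>
      intro s hs h
      have hcode : ∀ (Q : Program) (b : ℕ), HasCode Q b ((F.while x).code b) →
          HasCode Q (b + 2) (F.code (b + 2)) ∧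
            Q[b + 2 + F.len]? = some (.jumpPos x (b + 2)) := by
        intro Q b hQ
        have h1 := HasCode.tail (HasCode.tail hQ)
        exact ⟨h1.left, by simpa [F.length_code] using (HasCode.head h1.right)⟩
      by_cases hx : 0 < s.reg x
      · obtain ⟨s₁, t₁, ht₁, ⟨k, hk, hi⟩, hb₁, hr₁⟩ := hF K s hs h hx
        obtain ⟨s', t, ht, ⟨hx', k', hk', hi'⟩, hb, hr⟩ := ih k hk s₁ hb₁ hi
        refine ⟨s', 1 + t₁ + t, ?_, ⟨hx', k', by omega, hi'⟩, hb, fun Q b hQ => ?_⟩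
        · calc 1 + t₁ + t ≤ 1 + T + (k * (T + 1) + 1) := by omega
            _ = (k + 1) * (T + 1) + 1 := by ring
            _ ≤ K * (T + 1) + 1 := by gcongr; omega
        · obtain ⟨c1, c2⟩ := hcode Q b hQ
          refine Reach.trans (Reach.trans (c' := s.at (b + 2)) ?_ (hr₁ Q _ c1)) (hr Q b hQ)
          exact Reach.single (i := .jumpPos x (b + 2)) (by simpa [Store.at] using c2)
            (by simp [Instr.exec, Store.at, hx]) hs hs
      · refine ⟨s, 1, by omega, ⟨hx, K, le_rfl, h⟩, hs, fun Q b hQ => ?_⟩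
        obtain ⟨c1, c2⟩ := hcode Q b hQ
        exact Reach.single (i := .jumpPos x (b + 2)) (by simpa [Store.at] using c2)
          (by simp [Instr.exec, Store.at, hx, Frag.while]; omega) hs hs
  have hb1 : (s.setReg 39 1).Bounded B := hs.setReg _ (by simpa using hB)
  obtain ⟨s', t, ht, hp, hb, hr⟩ := key K _ hb1 h
  refine ⟨s', 1 + 1 + t, by omega, hp, hb, fun Q b hQ => ?_⟩
  refine Reach.trans (Reach.trans (c' := (s.setReg 39 1).at (b + 1)) ?_ ?_) (hr Q b hQ)
  · exact Reach.single (i := .const 39 1) (by simpa [Store.at] using HasCode.head hQ) rfl hs hb1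
  · exact Reach.single (i := .jumpPos 39 (b + 2 + F.len))
      (by simpa [Store.at] using HasCode.head (HasCode.tail hQ))
      (by simp [Instr.exec, Store.at, Store.setReg]) hb1 hb1

/-- `for reg[i] = 0, …, reg[x] - 1 do F`; register `t` holds the number of remaining rounds. -/
def Frag.for (i t x : ℕ) (F : Frag) : Frag :=
  (Frag.basic [.const i 0, .op .sub t x i]).seq
    (Frag.while t (F.seq (Frag.basic [.const t 1, .op .add i i t, .op .sub t x i])))

theorem Frag.Ensures.for {i t x : ℕ} {F : Frag} {B T : ℕ} (L : ℕ) (inv : ℕ → Store → Prop)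
    (hix : i ≠ x) (htx : t ≠ x) (hit : i ≠ t) (hi39 : i ≠ 39) (ht39 : t ≠ 39) (hx39 : x ≠ 39)
    (hstable : ∀ k s v r, r = i ∨ r = t ∨ r = 39 → inv k s → inv k (s.setReg r v))
    (hB : 1 ≤ B) {s : Store} (hs : s.Bounded B) (hx : s.reg x = L)
    (hF : ∀ k s, s.Bounded B → k < L → inv k s → s.reg i = k → s.reg x = L →
      F.Ensures B T (fun s' => inv (k + 1) s' ∧ s'.reg i = k ∧ s'.reg x = L) s)
    (h : inv 0 s) :
    (F.for i t x).Ensures B (L * (T + 4) + 5) (fun s' => inv L s' ∧ s'.reg x = L) s := by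
  have hLB : (L : ℤ) ≤ B := by
    have := hs.1 x
    rw [hx] at this
    exact (le_abs_self _).trans this
  have hB' : (1 : ℤ) ≤ B := by exact_mod_cast hB
  have e1 : (Frag.basic [.const i 0, .op .sub t x i]).Ensures B 2 (fun s' =>
      inv 0 s' ∧ s'.reg i = 0 ∧ s'.reg t = L ∧ s'.reg x = L) s := by
    refine .basic hs (by simp) ?_
    simp only [pre, Op.eval, Store.reg_setReg, if_neg hix.symm, if_neg htx.symm, if_neg hit,
      if_true, hx]
    refine ⟨by simp, by rw [sub_zero, abs_le]; omega, ?_, trivial, by simp, trivial⟩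
    exact hstable _ _ _ _ (by simp) (hstable _ _ _ _ (by simp) h)
  refine Ensures.mono (e1.seq (T' := L * ((T + 3) + 1) + 3)
    (post := fun s' => inv L s' ∧ s'.reg x = L) ?_) (by ring_nf; omega) fun _ _ h => h
  intro s₁ hb₁ ⟨h₁, h₂, h₃, h₄⟩
  refine Ensures.mono (Ensures.while (T := T + 3) (K := L) (fun k s' => ∃ j, j + k = L ∧
    inv j s' ∧ s'.reg i = j ∧ s'.reg t = k ∧ s'.reg x = L) hB ?_ hb₁ ?_) le_rfl ?_
  · rintro k s' hb ⟨j, hj, hinv, hi, ht, hx'⟩ hpos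
    rw [ht] at hpos
    refine Ensures.seq (hF j s' hb (by omega) hinv hi hx') ?_
    rintro s'' hb'' ⟨hinv', hi', hx''⟩
    refine .basic hb'' (by simp) ?_
    simp only [pre, Op.eval, Store.reg_setReg, if_neg hix.symm, if_neg htx.symm, if_neg hit,
      if_neg hit.symm, if_true, hx'', hi']
    refine ⟨by rw [abs_le]; omega, by rw [abs_le]; omega, by rw [abs_le]; omega,
      k - 1, by omega, j + 1, by omega, ?_, by push_cast; rfl, by omega, trivial⟩
    exact hstable _ _ _ _ (by simp) (hstable _ _ _ _ (by simp) (hstable _ _ _ _ (by simp) hinv'))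
  · exact ⟨0, by omega, hstable _ _ _ _ (by simp) h₁, by simp [Store.reg_setReg, hi39, h₂],
      by simp [Store.reg_setReg, ht39, h₃], by simp [Store.reg_setReg, hx39, h₄]⟩
  · rintro s' hb ⟨hneg, k, hk, j, hj, hinv, hi, ht, hx'⟩
    rw [ht] at hneg
    obtain rfl : j = L := by omega
    exact ⟨hinv, hx'⟩

/-! ### Running a program in a slice of the memory -/

/-- All registers mentioned in the instruction are below `R`. -/
def Instr.RegsBelow (R : ℕ) : Instr → Prop
  | .const dst _ => dst < R
  | .op _ dst x y => dst < R ∧ x < R ∧ y < R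
  | .load dst addr => dst < R ∧ addr < R
  | .store addr src => addr < R ∧ src < R
  | .jumpPos x _ => x < R

theorem Instr.RegsBelow.mono {R R' : ℕ} (h : R ≤ R') {i : Instr} (hi : i.RegsBelow R) :
    i.RegsBelow R' := by
  cases i <;> simp only [Instr.RegsBelow] at hi ⊢ <;> omega

theorem exists_regsBelow (P : Program) : ∃ R, ∀ i ∈ P, i.RegsBelow R := by
  induction P with
  | nil => exact ⟨0, by simp⟩
  | cons x P ih =>
    obtain ⟨R, hR⟩ := ih
    obtain ⟨R', hR'⟩ : ∃ R', x.RegsBelow R' := by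
      cases x with
      | const d k => exact ⟨d + 1, by simp [Instr.RegsBelow]⟩
      | op o d a b => exact ⟨d + a + b + 1, by simp only [Instr.RegsBelow]; omega⟩
      | load d a => exact ⟨d + a + 1, by simp only [Instr.RegsBelow]; omega⟩
      | store d a => exact ⟨d + a + 1, by simp only [Instr.RegsBelow]; omega⟩
      | jumpPos d t => exact ⟨d + 1, by simp [Instr.RegsBelow]⟩
    refine ⟨max R R', fun i hi => ?_⟩
    rcases List.mem_cons.1 hi with rfl | hi
    · exact hR'.mono (le_max_right _ _)
    · exact (hR i hi).mono (le_max_left _ _)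

/-- The three instructions that simulate one instruction of a program of length `L`: register `r`
is kept in register `40 + r`, the cell `z` in the cell `z * reg[4] + reg[5]`. -/
def simBlock (b L : ℕ) : Instr → List Instr
  | .const dst k => [.const 39 0, .const 39 0, .const (40 + dst) k]
  | .op o dst x y => [.const 39 0, .const 39 0, .op o (40 + dst) (40 + x) (40 + y)]
  | .load dst addr => [.op .mul 39 (40 + addr) 4, .op .add 39 39 5, .load (40 + dst) 39]
  | .store addr src => [.op .mul 39 (40 + addr) 4, .op .add 39 39 5, .store 39 (40 + src)]
  | .jumpPos x target => [.const 39 0, .const 39 0, .jumpPos (40 + x) (b + 3 * min target L)]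

theorem length_simBlock (b L : ℕ) (i : Instr) : (simBlock b L i).length = 3 := by
  cases i <;> rfl

/-- Code that runs the program `P` in a slice of the memory. -/
def Frag.sim (P : Program) : Frag where
  len := 3 * P.length
  code b := P.flatMap (simBlock b P.length)
  length_code b := by simp [List.length_flatMap, length_simBlock, mul_comm]

theorem HasCode.flatMap {Q : Program} {f : Instr → List Instr} (hf : ∀ x, (f x).length = 3)
    {l : List Instr} {b : ℕ} (h : HasCode Q b (l.flatMap f)) {i : ℕ} {x : Instr}
    (hx : l[i]? = some x) : HasCode Q (b + 3 * i) (f x) := by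
  induction l generalizing b i with
  | nil => simp at hx
  | cons y l ih =>
    rw [List.flatMap_cons] at h
    cases i with
    | zero =>
      obtain rfl : y = x := by simpa using hx
      simpa using h.left
    | succ i =>
      have := ih h.right (i := i) (by simpa using hx)
      rwa [hf, show b + 3 + 3 * i = b + 3 * (i + 1) by ring] at this

theorem Reach.single_at {Q : Program} {B b b' : ℕ} {s s' : Store} {i : Instr}
    (hi : Q[b]? = some i) (hc : i.exec (s.at b) = s'.at b')
    (h : s.Bounded B) (h' : s'.Bounded B) : Reach Q B (s.at b) (s'.at b') 1 :=
  Reach.single hi hc h h'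

theorem Reach.block {Q : Program} {B b b' : ℕ} {s s₁ s₂ s' : Store} {i j k : Instr}
    (h : HasCode Q b [i, j, k]) (hi : i.exec (s.at b) = s₁.at (b + 1))
    (hj : j.exec (s₁.at (b + 1)) = s₂.at (b + 2)) (hk : k.exec (s₂.at (b + 2)) = s'.at b')
    (hs : s.Bounded B) (h₁ : s₁.Bounded B) (h₂ : s₂.Bounded B) (h' : s'.Bounded B) :
    Reach Q B (s.at b) (s'.at b') 3 :=
  ((single_at h.head hi hs h₁).trans (single_at h.tail.head hj h₁ h₂)).trans
    (single_at h.tail.tail.head hk h₂ h')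

/-- The store `s` represents the configuration `c` of a program with registers below `R` in the
slice `J` modulo `S`, and agrees with `s₀` elsewhere. -/
structure Represents (R : ℕ) (S J : ℤ) (s₀ : Store) (c : Config) (s : Store) : Prop where
  reg : ∀ r < R, s.reg (40 + r) = c.reg r
  mem : ∀ z, s.mem (z * S + J) = c.mem z
  reg_frame : ∀ r < 39, s.reg r = s₀.reg r
  mem_frame : ∀ x, (∀ z, x ≠ z * S + J) → s.mem x = s₀.mem x

theorem Represents.setReg39 {R : ℕ} {S J : ℤ} {s₀ s : Store} {c : Config}
    (h : Represents R S J s₀ c s) (v : ℤ) : Represents R S J s₀ c (s.setReg 39 v) where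
  reg r hr := by rw [Store.reg_setReg, if_neg (by omega), h.reg r hr]
  mem := h.mem
  reg_frame r hr := by rw [Store.reg_setReg, if_neg (by omega), h.reg_frame r hr]
  mem_frame := h.mem_frame

theorem Represents.setReg {R : ℕ} {S J : ℤ} {s₀ s : Store} {c : Config}
    (h : Represents R S J s₀ c s) (pc d : ℕ) (v : ℤ) :
    Represents R S J s₀ ⟨pc, Function.update c.reg d v, c.mem⟩ (s.setReg (40 + d) v) where
  reg r hr := by
    simp [Store.reg_setReg, Function.update_apply, h.reg r hr]
  mem := h.mem
  reg_frame r hr := by rw [Store.reg_setReg, if_neg (by omega), h.reg_frame r hr]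
  mem_frame := h.mem_frame

theorem Represents.setMem {R : ℕ} {S J : ℤ} (hS : S ≠ 0) {s₀ s : Store} {c : Config}
    (h : Represents R S J s₀ c s) (pc : ℕ) (z v : ℤ) :
    Represents R S J s₀ ⟨pc, c.reg, Function.update c.mem z v⟩ (s.setMem (z * S + J) v) where
  reg := h.reg
  mem y := by
    simp [Store.mem_setMem, Function.update_apply, h.mem, hS]
  reg_frame := h.reg_frame
  mem_frame x hx := by rw [Store.mem_setMem, if_neg (hx z), h.mem_frame x hx]

theorem Represents.congr {R : ℕ} {S J : ℤ} {s₀ s : Store} {c : Config}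
    (h : Represents R S J s₀ c s) (pc : ℕ) : Represents R S J s₀ ⟨pc, c.reg, c.mem⟩ s :=
  ⟨h.reg, h.mem, h.reg_frame, h.mem_frame⟩

theorem Represents.step {P : Program} {R B b₀ : ℕ} {S J : ℤ} (hP : ∀ i ∈ P, i.RegsBelow R)
    (hS : S ≠ 0) {s₀ : Store} (hs4 : s₀.reg 4 = S) (hs5 : s₀.reg 5 = J)
    (hB : ∀ z : ℤ, |z| ≤ b₀ → |z * S| ≤ B ∧ |z * S + J| ≤ B) (hb₀ : b₀ ≤ B)
    {c : Config} {s : Store} (h : Represents R S J s₀ c s) (hs : s.Bounded B)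
    (hc : c.Bounded b₀) (hc' : (step P c).Bounded b₀) :
    ∃ s' t, t ≤ 3 ∧ s'.Bounded B ∧ Represents R S J s₀ (step P c) s' ∧
      ∀ (Q : Program) (b : ℕ), HasCode Q b ((Frag.sim P).code b) →
        Reach Q B (s.at (b + 3 * min c.pc P.length))
          (s'.at (b + 3 * min (step P c).pc P.length)) t := by
  rcases hi : P[c.pc]? with _ | i
  · have hstep : WordRAM.step P c = c := by simp [WordRAM.step, hi]
    rw [hstep]
    exact ⟨s, 0, by omega, hs, h, fun Q b _ => Reach.refl hs⟩
  have hstep : WordRAM.step P c = i.exec c := by simp [WordRAM.step, hi]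
  have hlt : c.pc < P.length := (List.getElem?_eq_some_iff.1 hi).1
  have hR := hP i (List.mem_of_getElem? hi)
  have hblock : ∀ (Q : Program) (b : ℕ), HasCode Q b ((Frag.sim P).code b) →
      HasCode Q (b + 3 * c.pc) (simBlock b P.length i) := fun Q b hQ =>
    HasCode.flatMap (length_simBlock b P.length) hQ hi
  have hb₀' : (b₀ : ℤ) ≤ B := by exact_mod_cast hb₀
  rw [hstep] at hc' ⊢
  rw [min_eq_left hlt.le]
  have hnext : ∀ b, b + 3 * min (c.pc + 1) P.length = b + 3 * c.pc + 3 := by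
    intro b; rw [min_eq_left (by omega)]; ring
  have h0 : ((s.setReg 39 0).setReg 39 0).Bounded B :=
    (hs.setReg _ (by simp)).setReg _ (by simp)
  have e1 : ∀ p, (Instr.const 39 0).exec (s.at p) = (s.setReg 39 0).at (p + 1) := fun _ => rfl
  have e2 : ∀ p, (Instr.const 39 0).exec ((s.setReg 39 0).at (p + 1)) =
    ((s.setReg 39 0).setReg 39 0).at (p + 2) := fun _ => rfl
  have addr : ∀ a < R, ∃ s₁ s₂ : Store, s₁.Bounded B ∧ s₂.Bounded B ∧
      Represents R S J s₀ c s₂ ∧ s₂.reg 39 = c.reg a * S + J ∧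
      ∀ p, (Instr.op .mul 39 (40 + a) 4).exec (s.at p) = s₁.at (p + 1) ∧
        (Instr.op .add 39 39 5).exec (s₁.at (p + 1)) = s₂.at (p + 2) := by
    intro a ha
    have hz := hB (c.reg a) (hc.1 a)
    refine ⟨s.setReg 39 (c.reg a * S), (s.setReg 39 (c.reg a * S)).setReg 39 (c.reg a * S + J),
      hs.setReg _ hz.1, (hs.setReg _ hz.1).setReg _ hz.2, (h.setReg39 _).setReg39 _,
      by simp [Store.setReg], fun p => ⟨?_, ?_⟩⟩
    · simp [Instr.exec, Store.at, Store.setReg, Op.eval, h.reg a ha, h.reg_frame 4, hs4]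
    · simp [Instr.exec, Store.at, Store.setReg, Op.eval, h.reg_frame 5, hs5]
  cases i with
  | const d k =>
    have hk : |k| ≤ (B : ℤ) := by simpa [Instr.exec] using (hc'.1 d).trans hb₀'
    refine ⟨_, 3, le_rfl, h0.setReg (40 + d) hk,
      ((h.setReg39 0).setReg39 0).setReg (c.pc + 1) d k, fun Q b hQ => ?_⟩
    exact Reach.block (hblock Q b hQ) (e1 _) (e2 _)
      (by simp only [Instr.exec, hnext]; rfl) hs (hs.setReg _ (by simp)) h0
      (h0.setReg (40 + d) hk)
  | op o d x y =>
    obtain ⟨hd, hx, hy⟩ := hR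
    have hk : |o.eval (c.reg x) (c.reg y)| ≤ (B : ℤ) := by
      simpa [Instr.exec] using (hc'.1 d).trans hb₀'
    refine ⟨_, 3, le_rfl, h0.setReg (40 + d) hk,
      ((h.setReg39 0).setReg39 0).setReg (c.pc + 1) d _, fun Q b hQ => ?_⟩
    refine Reach.block (hblock Q b hQ) (e1 _) (e2 _)
      ?_ hs (hs.setReg _ (by simp)) h0 (h0.setReg (40 + d) hk)
    simp only [Instr.exec, hnext]
    have r := ((h.setReg39 0).setReg39 0).reg
    have rx := r x hx
    have ry := r y hy
    simp only [Store.at]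
    rw [rx, ry]
    rfl
  | load d a =>
    obtain ⟨hd, ha⟩ := hR
    obtain ⟨s₁, s₂, hb₁, hb₂, hr₂, hv, hex⟩ := addr a ha
    have hk : |c.mem (c.reg a)| ≤ (B : ℤ) := (hc.2 _).trans hb₀'
    refine ⟨_, 3, le_rfl, hb₂.setReg (40 + d) hk, hr₂.setReg (c.pc + 1) d _, fun Q b hQ => ?_⟩
    refine Reach.block (hblock Q b hQ) (hex _).1 (hex _).2 ?_ hs hb₁ hb₂ (hb₂.setReg (40 + d) hk)
    simp only [Instr.exec, hnext, Store.at]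
    rw [hv, hr₂.mem]
    rfl
  | store a v =>
    obtain ⟨ha, hv'⟩ := hR
    obtain ⟨s₁, s₂, hb₁, hb₂, hr₂, hv, hex⟩ := addr a ha
    have hk : |c.reg v| ≤ (B : ℤ) := (hc.1 _).trans hb₀'
    refine ⟨_, 3, le_rfl, hb₂.setMem (c.reg a * S + J) hk,
      hr₂.setMem hS (c.pc + 1) (c.reg a) (c.reg v), fun Q b hQ => ?_⟩
    refine Reach.block (hblock Q b hQ) (hex _).1 (hex _).2 ?_ hs hb₁ hb₂ (hb₂.setMem _ hk)
    simp only [Instr.exec, hnext, Store.at]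
    rw [hv, hr₂.reg v hv']
    rfl
  | jumpPos x target =>
    have r := ((h.setReg39 0).setReg39 0).reg x hR
    refine ⟨_, 3, le_rfl, h0,
      ((h.setReg39 0).setReg39 0).congr (if 0 < c.reg x then target else c.pc + 1), fun Q b hQ => ?_⟩
    refine Reach.block (hblock Q b hQ) (e1 _) (e2 _) ?_ hs (hs.setReg _ (by simp)) h0 h0
    simp only [Instr.exec, Store.at, r]
    split_ifs
    · rfl
    · rw [hnext]

theorem Frag.Ensures.sim {P : Program} {R B b₀ t : ℕ} {S J : ℤ}
    (hP : ∀ i ∈ P, i.RegsBelow R) (hS : S ≠ 0) {s₀ : Store} (hs4 : s₀.reg 4 = S)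
    (hs5 : s₀.reg 5 = J) (hB : ∀ z : ℤ, |z| ≤ b₀ → |z * S| ≤ B ∧ |z * S + J| ≤ B)
    (hb₀ : b₀ ≤ B) {c : Config} (hpc : c.pc = 0) (hc : Represents R S J s₀ c s₀)
    (hs : s₀.Bounded B) (hcb : ∀ u ≤ t, ((WordRAM.step P)^[u] c).Bounded b₀)
    (hhalt : Halted P ((WordRAM.step P)^[t] c)) :
    (Frag.sim P).Ensures B (3 * t) (Represents R S J s₀ ((WordRAM.step P)^[t] c)) s₀ := by
  have key : ∀ u ≤ t, ∃ s' t', t' ≤ 3 * u ∧ s'.Bounded B ∧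
      Represents R S J s₀ ((WordRAM.step P)^[u] c) s' ∧
      ∀ (Q : Program) (b : ℕ), HasCode Q b ((Frag.sim P).code b) → Reach Q B (s₀.at b)
        (s'.at (b + 3 * min ((WordRAM.step P)^[u] c).pc P.length)) t' := by
    intro u hu
    induction u with
    | zero => exact ⟨s₀, 0, by omega, hs, hc, fun Q b _ => by
        simpa [hpc] using Reach.refl (Q := Q) (c := s₀.at b) hs⟩
    | succ u ih =>
      obtain ⟨s₁, t₁, ht₁, hb₁, hr₁, hreach₁⟩ := ih (by omega)
      have hcode := hcb u (by omega)
      have hcode' := hcb (u + 1) hu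
      rw [Function.iterate_succ_apply'] at hcode' ⊢
      obtain ⟨s₂, t₂, ht₂, hb₂, hr₂, hreach₂⟩ :=
        hr₁.step hP hS hs4 hs5 hB hb₀ hb₁ hcode hcode'
      exact ⟨s₂, t₁ + t₂, by omega, hb₂, hr₂, fun Q b hQ =>
        (hreach₁ Q b hQ).trans (hreach₂ Q b hQ)⟩
  obtain ⟨s', t', ht', hb', hr', hreach⟩ := key t le_rfl
  refine ⟨s', t', ht', hr', hb', fun Q b hQ => ?_⟩
  have := hreach Q b hQ
  rwa [min_eq_right hhalt] at this

end WordRAM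

/-! ### Bisections of paths -/

open Classical in
/-- The positions `p` such that exactly one of `p`, `p + 1` satisfies `f`, among the first `N`
natural numbers. -/
noncomputable def cutPositions (N : ℕ) (f : ℕ → Prop) : Finset ℕ :=
  {p ∈ Finset.range (N - 1) | ¬ (f p ↔ f (p + 1))}

theorem mem_cutPositions {N : ℕ} {f : ℕ → Prop} {p : ℕ} :
    p ∈ cutPositions N f ↔ p + 1 < N ∧ ¬ (f p ↔ f (p + 1)) := by
  simp [cutPositions]; omega

theorem cutWeight_pathGraph {N : ℕ} (w : Sym2 (Fin N) → ℤ) (wt : ℕ → ℤ)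
    (hw : ∀ (p : ℕ) (h : p + 1 < N), w s(⟨p, by omega⟩, ⟨p + 1, h⟩) = wt p)
    (A : Finset (Fin N)) :
    cutWeight (SimpleGraph.pathGraph N) w A =
      ∑ p ∈ cutPositions N (fun v => ∃ h : v < N, (⟨v, h⟩ : Fin N) ∈ A), wt p := by
  classical
  unfold cutWeight
  symm
  refine Finset.sum_bij (fun p hp => s(⟨p, by have := (mem_cutPositions.1 hp).1; omega⟩,
    ⟨p + 1, (mem_cutPositions.1 hp).1⟩)) ?_ ?_ ?_ ?_
  · intro p hp
    obtain ⟨h, hne⟩ := mem_cutPositions.1 hp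
    simp only [Finset.mem_filter, SimpleGraph.mem_edgeFinset, SimpleGraph.mem_edgeSet,
      SimpleGraph.pathGraph_adj, Finset.mem_compl]
    refine ⟨by simp, ?_⟩
    have h' : p < N := by omega
    by_cases h1 : (⟨p, h'⟩ : Fin N) ∈ A
    · refine ⟨_, h1, ⟨p + 1, h⟩, fun h2 => hne ?_, rfl⟩
      simp [h, h', h1, h2]
    · refine ⟨⟨p + 1, h⟩, ?_, _, h1, Sym2.eq_swap⟩
      by_contra h2
      exact hne (by simp [h1, h2])
  · intro p hp q hq heq
    simp only [Sym2.eq_iff, Fin.mk.injEq] at heq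
    omega
  · intro e he
    simp only [Finset.mem_filter, SimpleGraph.mem_edgeFinset, Finset.mem_compl] at he
    obtain ⟨he, u, hu, v, hv, rfl⟩ := he
    rw [SimpleGraph.mem_edgeSet, SimpleGraph.pathGraph_adj] at he
    rcases he with he | he
    · refine ⟨u, mem_cutPositions.2 ⟨by omega, fun h => hv ?_⟩, ?_⟩
      · obtain ⟨h', hv'⟩ := h.1 ⟨u.2, hu⟩
        convert hv'
        exact he.symm
      · simp [he]
    · refine ⟨v, mem_cutPositions.2 ⟨by omega, fun h => hv ?_⟩, ?_⟩
      · obtain ⟨h', hv'⟩ := h.2 ⟨by omega, by simpa [he] using hu⟩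
        exact hv'
      · simp only [he]
        exact Sym2.eq_swap
  · intro p hp
    exact (hw p (mem_cutPositions.1 hp).1).symm

open Classical in
theorem card_eq_card_filter_range {N : ℕ} (A : Finset (Fin N)) :
    A.card = ((Finset.range N).filter fun v => ∃ h : v < N, (⟨v, h⟩ : Fin N) ∈ A).card := by
  rw [← Finset.card_map Fin.valEmbedding]
  congr 1
  ext v
  simp only [Finset.mem_map, Finset.mem_filter, Finset.mem_range, Fin.valEmbedding_apply]
  constructor
  · rintro ⟨a, ha, rfl⟩
    exact ⟨a.2, a.2, ha⟩
  · rintro ⟨_, h, ha⟩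
    exact ⟨_, ha, rfl⟩

open Classical in
theorem card_two_intervals {N p₁ p₂ p₃ : ℕ} (h₁ : p₁ ≤ p₂) (h₂ : p₂ ≤ p₃) (h₃ : p₃ < N) :
    ((Finset.range N).filter fun v => v ≤ p₁ ∨ p₂ < v ∧ v ≤ p₃).card + p₂ = p₁ + 1 + p₃ := by
  have : ((Finset.range N).filter fun v => v ≤ p₁ ∨ p₂ < v ∧ v ≤ p₃) =
      Finset.range (p₁ + 1) ∪ Finset.Ioc p₂ p₃ := by
    ext v
    simp only [Finset.mem_filter, Finset.mem_range, Finset.mem_union, Finset.mem_Ioc]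
    omega
  rw [this, Finset.card_union_of_disjoint, Finset.card_range, Nat.card_Ioc]
  · omega
  · rw [Finset.disjoint_left]
    intro v
    simp only [Finset.mem_range, Finset.mem_Ioc]
    omega

/-- A predicate with at most three changes, the sequence of changes being padded by `N - 1`. -/
theorem iff_of_cutPositions {N p₁ p₂ p₃ : ℕ} {f : ℕ → Prop}
    (h₁₂ : p₁ < p₂ ∨ p₁ = N - 1 ∧ p₂ = N - 1) (h₂₃ : p₂ < p₃ ∨ p₂ = N - 1 ∧ p₃ = N - 1)
    (hcut : ∀ p, p ∈ cutPositions N f ↔ p + 1 < N ∧ (p = p₁ ∨ p = p₂ ∨ p = p₃))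
    {v : ℕ} (hv : v < N) : f v ↔ (f 0 ↔ (v ≤ p₁ ∨ p₂ < v ∧ v ≤ p₃)) := by
  induction v with
  | zero => simp
  | succ v ih =>
    have ih := ih (by omega)
    have hc := hcut v
    rw [mem_cutPositions] at hc
    by_cases hmem : v = p₁ ∨ v = p₂ ∨ v = p₃
    · have hne := (hc.2 ⟨hv, hmem⟩).2
      have : (v + 1 ≤ p₁ ∨ p₂ < v + 1 ∧ v + 1 ≤ p₃) ↔ ¬ (v ≤ p₁ ∨ p₂ < v ∧ v ≤ p₃) := by
        clear hc ih hcut hne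
        rcases hmem with h | h | h <;> constructor <;> omega
      rw [this]
      rw [not_iff] at hne
      rw [← hne, ih, not_iff_comm, not_iff]
      generalize (v ≤ p₁ ∨ p₂ < v ∧ v ≤ p₃) = D
      by_cases f 0 <;> by_cases D <;> simp_all
    · have heq : f v ↔ f (v + 1) := by
        by_contra hne
        exact hmem (hc.1 ⟨hv, hne⟩).2
      have : (v + 1 ≤ p₁ ∨ p₂ < v + 1 ∧ v + 1 ≤ p₃) ↔ (v ≤ p₁ ∨ p₂ < v ∧ v ≤ p₃) := by
        clear hc ih hcut heq
        constructor <;> omega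
      rw [this, ← heq]
      exact ih

open Classical in
theorem balance_of_cutPositions {N p₁ p₂ p₃ : ℕ} {f : ℕ → Prop} (h₃ : p₃ < N)
    (h₁₂ : p₁ < p₂ ∨ p₁ = N - 1 ∧ p₂ = N - 1) (h₂₃ : p₂ < p₃ ∨ p₂ = N - 1 ∧ p₃ = N - 1)
    (hcut : ∀ p, p ∈ cutPositions N f ↔ p + 1 < N ∧ (p = p₁ ∨ p = p₂ ∨ p = p₃))
    (hf : 2 * ((Finset.range N).filter f).card = N) :
    2 * (p₁ + 1 + p₃) = N + 2 * p₂ := by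
  have hcard := card_two_intervals (N := N) (p₁ := p₁) (p₂ := p₂) (p₃ := p₃)
    (by omega) (by omega) h₃
  have key := fun v (hv : v < N) => iff_of_cutPositions h₁₂ h₂₃ hcut hv
  by_cases h0 : f 0
  · have : (Finset.range N).filter f =
        (Finset.range N).filter fun v => v ≤ p₁ ∨ p₂ < v ∧ v ≤ p₃ := by
      refine Finset.filter_congr fun v hv => ?_
      rw [key v (Finset.mem_range.1 hv)]
      simp [h0]
    rw [this] at hf
    omega
  · have : (Finset.range N).filter f =
        (Finset.range N).filter fun v => ¬ (v ≤ p₁ ∨ p₂ < v ∧ v ≤ p₃) := by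
      refine Finset.filter_congr fun v hv => ?_
      rw [key v (Finset.mem_range.1 hv)]
      simp [h0]
    rw [this] at hf
    have := Finset.card_filter_add_card_filter_not (s := Finset.range N)
      (fun v => v ≤ p₁ ∨ p₂ < v ∧ v ≤ p₃)
    rw [Finset.card_range] at this
    omega

/-! ### The path that encodes three sequences -/

/-- The weights of the edges of a path on `28 * m + 2` vertices whose bisections of small weight
correspond to the pairs of indices `i, j < m`. -/
def gadgetWeight (m : ℕ) (W : ℤ) (a b c : ℕ → ℤ) (p : ℕ) : ℤ :=
  if 3 * m ≤ p ∧ p < 4 * m then W + a (p - 3 * m)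
  else if 9 * m ≤ p ∧ p < 11 * m then W - c (p - 9 * m)
  else if 20 * m ≤ p ∧ p < 21 * m then W + b (p - 20 * m)
  else 4 * W

theorem gadgetWeight_ge {m : ℕ} {W X : ℤ} {a b c : ℕ → ℤ} (hX : 0 ≤ X) (hW : 7 * X < W)
    (ha : ∀ i < m, |a i| ≤ X) (hb : ∀ i < m, |b i| ≤ X) (hc : ∀ i < 2 * m, |c i| ≤ X) (p : ℕ) :
    W - X ≤ gadgetWeight m W a b c p := by
  unfold gadgetWeight
  split_ifs with h1 h2 h3
  · have := abs_le.1 (ha (p - 3 * m) (by omega)); omega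
  · have := abs_le.1 (hc (p - 9 * m) (by omega)); omega
  · have := abs_le.1 (hb (p - 20 * m) (by omega)); omega
  · omega

theorem gadgetWeight_triple {m : ℕ} {W : ℤ} {a b c : ℕ → ℤ} {i j : ℕ} (hi : i < m) (hj : j < m) :
    gadgetWeight m W a b c (3 * m + i) + gadgetWeight m W a b c (9 * m + (i + j)) +
      gadgetWeight m W a b c (20 * m + j) = 3 * W + (a i + b j - c (i + j)) := by
  unfold gadgetWeight
  rw [if_pos (by omega), if_neg (by omega), if_pos (by omega), if_neg (by omega),
    if_neg (by omega), if_pos (by omega)]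
  simp only [Nat.add_sub_cancel_left]
  ring

theorem sum_triple {m : ℕ} (g : ℕ → ℤ) {i j : ℕ} (hi : i < m) (hj : j < m) :
    ∑ p ∈ ({3 * m + i, 9 * m + (i + j), 20 * m + j} : Finset ℕ), g p =
      g (3 * m + i) + g (9 * m + (i + j)) + g (20 * m + j) := by
  rw [Finset.sum_insert (by simp; omega), Finset.sum_insert (by simp; omega),
    Finset.sum_singleton, add_assoc]

/-- The bisection that corresponds to a pair of indices. -/
theorem exists_bisection_of_pair {m i j : ℕ} (hi : i < m) (hj : j < m) :
    ∃ A : Finset (Fin (28 * m + 2)), IsBisection A ∧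
      cutPositions (28 * m + 2) (fun v => ∃ h : v < 28 * m + 2, (⟨v, h⟩ : Fin _) ∈ A) =
        {3 * m + i, 9 * m + (i + j), 20 * m + j} := by
  classical
  let A : Finset (Fin (28 * m + 2)) := Finset.univ.filter fun v =>
    (v : ℕ) ≤ 3 * m + i ∨ 9 * m + (i + j) < v ∧ (v : ℕ) ≤ 20 * m + j
  have hA : ∀ v, (∃ h : v < 28 * m + 2, (⟨v, h⟩ : Fin _) ∈ A) ↔
      v ≤ 3 * m + i ∨ 9 * m + (i + j) < v ∧ v ≤ 20 * m + j := by
    intro v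
    simp only [A, Finset.mem_filter, Finset.mem_univ, true_and, exists_prop]
    omega
  refine ⟨A, ?_, ?_⟩
  · have hc := card_eq_card_filter_range A
    have h2 := card_two_intervals (N := 28 * m + 2) (p₁ := 3 * m + i) (p₂ := 9 * m + (i + j))
      (p₃ := 20 * m + j) (by omega) (by omega) (by omega)
    simp only [hA] at hc
    rw [← hc] at h2
    have := Finset.card_compl_add_card A
    rw [Fintype.card_fin] at this
    unfold IsBisection
    omega
  · ext p
    rw [mem_cutPositions, hA, hA]
    simp only [Finset.mem_insert, Finset.mem_singleton]
    omega

/-- The possible changes of a balanced predicate within the three regions. -/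
theorem triple_of_balanced {m : ℕ} {f : ℕ → Prop} (hm : 1 ≤ m)
    (hcard : (cutPositions (28 * m + 2) f).card ≤ 3)
    (hreg : ∀ p ∈ cutPositions (28 * m + 2) f, 3 * m ≤ p ∧ p < 4 * m ∨
      9 * m ≤ p ∧ p < 11 * m ∨ 20 * m ≤ p ∧ p < 21 * m)
    (hf : ∀ p₁ p₂ p₃, p₃ < 28 * m + 2 →
      (p₁ < p₂ ∨ p₁ = 28 * m + 2 - 1 ∧ p₂ = 28 * m + 2 - 1) →
      (p₂ < p₃ ∨ p₂ = 28 * m + 2 - 1 ∧ p₃ = 28 * m + 2 - 1) →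
      (∀ p, p ∈ cutPositions (28 * m + 2) f ↔
        p + 1 < 28 * m + 2 ∧ (p = p₁ ∨ p = p₂ ∨ p = p₃)) →
      2 * (p₁ + 1 + p₃) = 28 * m + 2 + 2 * p₂) :
    ∃ i < m, ∃ j < m, cutPositions (28 * m + 2) f =
      {3 * m + i, 9 * m + (i + j), 20 * m + j} := by
  set D := cutPositions (28 * m + 2) f with hD
  set e := D.orderEmbOfFin rfl
  have hrange : ∀ p, p ∈ D ↔ ∃ k, e k = p := fun p => by
    rw [← Finset.mem_coe, ← Finset.range_orderEmbOfFin D rfl]; rfl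
  have hmem : ∀ k, e k ∈ D := fun k => (hrange _).2 ⟨k, rfl⟩
  rcases h : D.card with _ | _ | _ | _ | _
  · rw [Finset.card_eq_zero] at h
    have := hf (28 * m + 1) (28 * m + 1) (28 * m + 1) (by omega) (by omega) (by omega)
      fun p => by rw [h]; simp; omega
    omega
  · obtain ⟨p, h⟩ := Finset.card_eq_one.1 h
    have hp := hreg p (by simp [h])
    have := hf p (28 * m + 1) (28 * m + 1) (by omega) (by omega) (by omega)
      fun p => by rw [h]; simp; omega
    omega
  · have hlt : e ⟨0, by omega⟩ < e ⟨1, by omega⟩ := e.strictMono (by simp)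
    have h0 := hreg _ (hmem ⟨0, by omega⟩)
    have h1 := hreg _ (hmem ⟨1, by omega⟩)
    have hall : ∀ p, p ∈ D ↔ p = e ⟨0, by omega⟩ ∨ p = e ⟨1, by omega⟩ := by
      intro p
      rw [hrange]
      constructor
      · rintro ⟨⟨k, hk⟩, rfl⟩
        obtain rfl | rfl : k = 0 ∨ k = 1 := by omega
        all_goals simp
      · rintro (rfl | rfl)
        all_goals exact ⟨_, rfl⟩
    have := hf (e ⟨0, by omega⟩) (e ⟨1, by omega⟩) (28 * m + 1) (by omega) (by omega) (by omega)
      fun p => by rw [hall]; omega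
    omega
  · have hlt : e ⟨0, by omega⟩ < e ⟨1, by omega⟩ := e.strictMono (by simp)
    have hlt' : e ⟨1, by omega⟩ < e ⟨2, by omega⟩ := e.strictMono (by simp)
    have h0 := hreg _ (hmem ⟨0, by omega⟩)
    have h1 := hreg _ (hmem ⟨1, by omega⟩)
    have h2 := hreg _ (hmem ⟨2, by omega⟩)
    have hall : ∀ p, p ∈ D ↔ p = e ⟨0, by omega⟩ ∨ p = e ⟨1, by omega⟩ ∨ p = e ⟨2, by omega⟩ := by
      intro p
      rw [hrange]
      constructor
      · rintro ⟨⟨k, hk⟩, rfl⟩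
        obtain rfl | rfl | rfl : k = 0 ∨ k = 1 ∨ k = 2 := by omega
        all_goals simp
      · rintro (rfl | rfl | rfl)
        all_goals exact ⟨_, rfl⟩
    have := hf (e ⟨0, by omega⟩) (e ⟨1, by omega⟩) (e ⟨2, by omega⟩) (by omega) (by omega)
      (by omega) fun p => by rw [hall]; omega
    generalize e ⟨0, by omega⟩ = x at *
    generalize e ⟨1, by omega⟩ = y at *
    generalize e ⟨2, by omega⟩ = z at *
    refine ⟨x - 3 * m, by omega, z - 20 * m, by omega, ?_⟩
    ext p
    rw [hall]
    simp only [Finset.mem_insert, Finset.mem_singleton]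
    omega
  · omega

theorem gadget_minBisection {m : ℕ} (hm : 1 ≤ m) {W X : ℤ} {a b c : ℕ → ℤ} (hX : 0 ≤ X)
    (hW : 7 * X < W) (ha : ∀ i < m, |a i| ≤ X) (hb : ∀ i < m, |b i| ≤ X)
    (hc : ∀ i < 2 * m, |c i| ≤ X) {w : Sym2 (Fin (28 * m + 2)) → ℤ}
    (hw : ∀ (p : ℕ) (h : p + 1 < 28 * m + 2),
      w s(⟨p, by omega⟩, ⟨p + 1, h⟩) = gadgetWeight m W a b c p)
    {A : Finset (Fin (28 * m + 2))}
    (hA : IsMinBisection (SimpleGraph.pathGraph (28 * m + 2)) w A) :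
    ∃ i < m, ∃ j < m,
      cutPositions (28 * m + 2) (fun v => ∃ h : v < 28 * m + 2, (⟨v, h⟩ : Fin _) ∈ A) =
        {3 * m + i, 9 * m + (i + j), 20 * m + j} ∧
      ∀ i' < m, ∀ j' < m, a i + b j - c (i + j) ≤ a i' + b j' - c (i' + j') := by
  classical
  have hle : ∀ i < m, ∀ j < m, ∑ p ∈ cutPositions (28 * m + 2)
      (fun v => ∃ h : v < 28 * m + 2, (⟨v, h⟩ : Fin _) ∈ A), gadgetWeight m W a b c p ≤
        3 * W + (a i + b j - c (i + j)) := by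
    intro i hi j hj
    obtain ⟨A', hA', hcut⟩ := exists_bisection_of_pair hi hj
    have := hA.2 A' hA'
    rwa [cutWeight_pathGraph w _ hw, cutWeight_pathGraph w _ hw, hcut, sum_triple _ hi hj,
      gadgetWeight_triple hi hj] at this
  have hlow := gadgetWeight_ge hX hW ha hb hc
  have hup := hle 0 hm 0 hm
  have ha0 := abs_le.1 (ha 0 hm)
  have hb0 := abs_le.1 (hb 0 hm)
  have hc0 := abs_le.1 (hc 0 (by omega))
  rw [add_zero] at hup
  obtain ⟨i, hi, j, hj, hcut⟩ : ∃ i < m, ∃ j < m,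
      cutPositions (28 * m + 2) (fun v => ∃ h : v < 28 * m + 2, (⟨v, h⟩ : Fin _) ∈ A) =
        {3 * m + i, 9 * m + (i + j), 20 * m + j} := by
    refine triple_of_balanced hm ?_ ?_ ?_
    · by_contra hcard
      have h1 := Finset.card_nsmul_le_sum (cutPositions (28 * m + 2)
        (fun v => ∃ h : v < 28 * m + 2, (⟨v, h⟩ : Fin _) ∈ A)) _ _ (fun p _ => hlow p)
      rw [nsmul_eq_mul] at h1
      have h2 : (4 : ℤ) ≤ ((cutPositions (28 * m + 2) (fun v => ∃ h : v < 28 * m + 2,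
        (⟨v, h⟩ : Fin _) ∈ A)).card : ℤ) := by exact_mod_cast not_le.1 hcard
      have h3 := mul_le_mul_of_nonneg_right h2 (show 0 ≤ W - X by omega)
      linarith
    · intro p hp
      by_contra hreg
      have h1 := Finset.single_le_sum (f := gadgetWeight m W a b c)
        (fun p _ => (show 0 ≤ W - X by omega).trans (hlow p)) hp
      have h2 : gadgetWeight m W a b c p = 4 * W := by
        unfold gadgetWeight
        rw [if_neg (by omega), if_neg (by omega), if_neg (by omega)]
      linarith
    · intro p₁ p₂ p₃ h₃ h₁₂ h₂₃ hcut
      refine balance_of_cutPositions h₃ h₁₂ h₂₃ hcut ?_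
      have h0 := card_eq_card_filter_range A
      have h1 := hA.1
      have h2 := Finset.card_compl_add_card A
      rw [Fintype.card_fin] at h2
      unfold IsBisection at h1
      have h3 : 2 * A.card = 28 * m + 2 := by omega
      rw [h0] at h3
      convert h3
  refine ⟨i, hi, j, hj, hcut, fun i' hi' j' hj' => ?_⟩
  have := hle i' hi' j' hj'
  rw [hcut, sum_triple _ hi hj, gadgetWeight_triple hi hj] at this
  linarith

namespace WordRAM

/-! ### Writing to and reading from a slice of the memory -/

/-- Write the values `reg[22] + reg[23] * mem[reg[20] + i]`, `i < reg[21]`, to the cells from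
`reg[19]` on of the slice `reg[5]` modulo `reg[4]`. -/
def Frag.fill : Frag :=
  .for 30 31 21 (.basic [.op .add 32 19 30, .op .mul 32 32 4, .op .add 32 32 5, .op .add 33 20 30,
    .load 33 33, .op .mul 33 23 33, .op .add 33 22 33, .store 32 33])

theorem Frag.Ensures.fill {B len : ℕ} {S J d src C σ : ℤ} {s : Store} {val : ℕ → ℤ}
    (hB : 1 ≤ B) (hs : s.Bounded B) (hS : S ≠ 0) (h4 : s.reg 4 = S) (h5 : s.reg 5 = J)
    (h19 : s.reg 19 = d) (h20 : s.reg 20 = src) (h21 : s.reg 21 = len) (h22 : s.reg 22 = C)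
    (h23 : s.reg 23 = σ)
    (haddr : ∀ i : ℕ, i < len → |d + i| ≤ B ∧ |(d + i) * S| ≤ B ∧ |(d + i) * S + J| ≤ B)
    (hsrc : ∀ i : ℕ, i < len → |src + i| ≤ B)
    (hval : ∀ i : ℕ, i < len → ∀ mem' : ℤ → ℤ, (∀ x, (∀ z, x ≠ z * S + J) → mem' x = s.mem x) →
      |σ * mem' (src + i)| ≤ B ∧ C + σ * mem' (src + i) = val i ∧ |val i| ≤ B) :
    Frag.fill.Ensures B (len * 12 + 5) (fun s' => (∀ r < 30, s'.reg r = s.reg r) ∧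
      (∀ z, s'.mem (z * S + J) =
        if d ≤ z ∧ z < d + len then val (z - d).toNat else s.mem (z * S + J)) ∧
      ∀ x, (∀ z, x ≠ z * S + J) → s'.mem x = s.mem x) s := by
  refine Ensures.mono (Ensures.for (T := 8) len (fun k s' => (∀ r < 30, s'.reg r = s.reg r) ∧
      (∀ z, s'.mem (z * S + J) =
        if d ≤ z ∧ z < d + k then val (z - d).toNat else s.mem (z * S + J)) ∧
      ∀ x, (∀ z, x ≠ z * S + J) → s'.mem x = s.mem x) (by simp) (by simp) (by simp) (by simp)
    (by simp) (by simp) ?_ hB hs h21 ?_ ?_) le_rfl fun _ _ h => h.1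
  · rintro k s' v r hr ⟨h1, h2, h3⟩
    refine ⟨fun q hq => ?_, h2, h3⟩
    rw [Store.reg_setReg, if_neg (by omega), h1 q hq]
  · rintro k s' hb hk ⟨h1, h2, h3⟩ h30 h21'
    obtain ⟨a1, a2, a3⟩ := haddr k hk
    obtain ⟨v1, v2, v3⟩ := hval k hk s'.mem h3
    refine .basic hb (by simp) ?_
    have e4 := (h1 4 (by simp)).trans h4
    have e5 := (h1 5 (by simp)).trans h5
    have e19 := (h1 19 (by simp)).trans h19
    have e20 := (h1 20 (by simp)).trans h20
    have e22 := (h1 22 (by simp)).trans h22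
    have e23 := (h1 23 (by simp)).trans h23
    simp only [pre, Op.eval, Store.reg_setReg, Store.reg_setMem, Store.mem_setReg,
      Nat.reduceEqDiff, if_true, if_false, e4, e5, e19, e20, e22, e23, h30, h21', v2]
    refine ⟨a1, a2, a3, hsrc k hk, v1, v3, ⟨fun r hr => ?_, fun z => ?_, fun x hx => ?_⟩,
      trivial, trivial⟩
    · simp only [show r ≠ 32 by omega, show r ≠ 33 by omega, if_false]
      exact h1 r hr
    · rw [Store.mem_setMem]
      simp only [Store.mem_setReg, h2, add_left_inj, mul_eq_mul_right_iff, hS, or_false]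
      push_cast
      split_ifs with g1 g2 g3 g4 g5
      · subst g1; congr 1; omega
      · omega
      · rfl
      · omega
      · omega
      · rfl
    · rw [Store.mem_setMem, if_neg (hx _)]
      exact h3 x hx
  · exact ⟨fun _ _ => rfl, fun z => by rw [if_neg (by push_cast; omega)], fun _ _ => rfl⟩

/-- Compute in register `34` the sum of the numbers `i < reg[21]` such that the cells `reg[19] + i`
and `reg[19] + i + 1` of the slice differ. -/
def Frag.locate : Frag :=
  (Frag.basic [.const 34 0]).seq (.for 30 31 21 (.basic [.op .add 32 19 30, .op .mul 32 32 4,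
    .op .add 32 32 5, .load 33 32, .op .add 32 32 4, .load 32 32, .op .sub 33 33 32,
    .op .mul 33 33 33, .op .mul 33 33 30, .op .add 34 34 33]))

theorem Frag.Ensures.locate {B len i₀ : ℕ} {S J d : ℤ} {s : Store}
    (hB : 1 ≤ B) (hs : s.Bounded B) (h4 : s.reg 4 = S) (h5 : s.reg 5 = J)
    (h19 : s.reg 19 = d) (h21 : s.reg 21 = len)
    (haddr : ∀ i : ℕ, i ≤ len → |d + i| ≤ B ∧ |(d + i) * S| ≤ B ∧ |(d + i) * S + J| ≤ B)
    (hi₀ : i₀ < len)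
    (hval : ∀ i : ℕ, i < len →
      (s.mem ((d + i) * S + J) - s.mem ((d + (i + 1)) * S + J)) *
        (s.mem ((d + i) * S + J) - s.mem ((d + (i + 1)) * S + J)) = if i = i₀ then 1 else 0) :
    Frag.locate.Ensures B (len * 14 + 6) (fun s' => (∀ r < 30, s'.reg r = s.reg r) ∧
      s'.mem = s.mem ∧ s'.reg 34 = i₀) s := by
  have hlen : (len : ℤ) ≤ B := by
    have := hs.1 21
    rw [h21] at this
    exact (le_abs_self _).trans this
  have e1 : (Frag.basic [.const 34 0]).Ensures B 1 (fun s' => s' = s.setReg 34 0) s :=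
    .basic hs (by simp) ⟨by simp, rfl⟩
  refine (e1.seq (T' := len * 14 + 5) ?_).mono (by omega) fun _ _ h => h
  rintro s₁ hb₁ rfl
  refine Ensures.mono (Ensures.for (T := 10) len (fun k s' => (∀ r < 30, s'.reg r = s.reg r) ∧
      s'.mem = s.mem ∧ s'.reg 34 = if i₀ < k then (i₀ : ℤ) else 0) (by simp) (by simp) (by simp)
      (by simp) (by simp) (by simp) ?_ hB hb₁ (by simp [Store.reg_setReg, h21]) ?_ ?_) le_rfl
      fun _ _ h => ⟨h.1.1, h.1.2.1, by rw [h.1.2.2, if_pos hi₀]⟩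
  · rintro k s' v r hr ⟨h1, h2, h3⟩
    refine ⟨fun q hq => ?_, h2, ?_⟩
    · rw [Store.reg_setReg, if_neg (by omega), h1 q hq]
    · rw [Store.reg_setReg, if_neg (by omega), h3]
  · rintro k s' hb hk ⟨h1, h2, h3⟩ h30 h21'
    obtain ⟨a1, a2, a3⟩ := haddr k hk.le
    have a4 := (haddr (k + 1) hk).2.2
    have v := hval k hk
    refine .basic hb (by simp) ?_
    have e4 := (h1 4 (by simp)).trans h4
    have e5 := (h1 5 (by simp)).trans h5
    have e19 := (h1 19 (by simp)).trans h19
    have ea : (d + (k : ℤ)) * S + J + S = (d + (k + 1)) * S + J := by ring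
    push_cast at a4
    simp only [pre, Op.eval, Store.reg_setReg, Store.mem_setReg,
      Nat.reduceEqDiff, if_true, if_false, e4, e5, e19, h30, h21', h2, h3, ea, v]
    have hd : |s.mem ((d + k) * S + J) - s.mem ((d + (k + 1)) * S + J)| ≤ 1 := by
      rw [← sq_le_one_iff_abs_le_one, sq, v]
      split_ifs <;> simp
    have hB' : (1 : ℤ) ≤ B := by exact_mod_cast hB
    have fin : (if i₀ < k then (i₀ : ℤ) else 0) + (if k = i₀ then (1 : ℤ) else 0) * k =
        if i₀ < k + 1 then (i₀ : ℤ) else 0 := by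
      by_cases h : k = i₀
      · simp [h]
      · by_cases h' : i₀ < k
        · simp [h, h', show i₀ < k + 1 by omega]
        · simp [h, h', show ¬ i₀ < k + 1 by omega]
    rw [fin]
    refine ⟨a1, a2, a3, a4, hd.trans hB', ?_, ?_, ?_, ⟨fun r hr => ?_, by trivial, by trivial⟩,
      trivial, trivial⟩
    · split_ifs <;> simp [hB]
    · split_ifs
      · rw [one_mul, abs_le]; omega
      · simp
    · split_ifs
      · rw [abs_le]; omega
      · simp
    · simp only [show r ≠ 32 by omega, show r ≠ 33 by omega, show r ≠ 34 by omega, if_false]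
      exact h1 r hr
  · refine ⟨fun r hr => ?_, rfl, ?_⟩
    · rw [Store.reg_setReg, if_neg (by omega)]
    · simp [Store.reg_setReg]

/-- Set the registers of the simulated program to their initial values for inputs of size
`reg[19]`. -/
def Frag.reset (R : ℕ) : Frag :=
  .basic ((List.range R).map (fun r => Stmt.const (40 + r) 0) ++
    [.const 40 0, .op .add 40 40 19])

theorem pre_append {B : ℕ} {post : Store → Prop} {l l' : List Stmt} {s : Store}
    (h : pre B (pre B post l') l s) : pre B post (l ++ l') s := by
  induction l generalizing s with
  | nil => exact h
  | cons x l ih =>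
    cases x with
    | const => exact ⟨h.1, ih h.2⟩
    | op => exact ⟨h.1, ih h.2⟩
    | load => exact ih (s := Store.setReg _ _ _) h
    | store => exact ih (s := Store.setMem _ _ _) h

theorem pre_range {B : ℕ} {post : Store → Prop} {R : ℕ} {s : Store}
    (h : ∀ s' : Store, (∀ r < R, s'.reg (40 + r) = 0) → (∀ r < 40, s'.reg r = s.reg r) →
      s'.mem = s.mem → post s') :
    pre B post ((List.range R).map fun r => Stmt.const (40 + r) 0) s := by
  induction R generalizing post with
  | zero => exact h s (by simp) (fun _ _ => rfl) rfl
  | succ R ih =>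
    rw [List.range_succ, List.map_append]
    refine pre_append (ih fun s' h1 h2 h3 => ⟨by simp, ?_⟩)
    refine h _ (fun r hr => ?_) (fun r hr => ?_) h3
    · rw [Store.reg_setReg]
      split_ifs with h'
      · rfl
      · exact h1 r (by omega)
    · rw [Store.reg_setReg, if_neg (by omega), h2 r hr]

theorem Frag.Ensures.reset {B R : ℕ} {N : ℤ} {s : Store} (hs : s.Bounded B)
    (h19 : s.reg 19 = N) :
    (Frag.reset R).Ensures B (R + 2) (fun s' => (∀ r < R, s'.reg (40 + r) = if r = 0 then N else 0) ∧
      (∀ r < 40, s'.reg r = s.reg r) ∧ s'.mem = s.mem) s := by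
  refine .basic hs (by simp) (pre_append (pre_range fun s' h1 h2 h3 => ?_))
  have hN := hs.1 19
  rw [h19] at hN
  simp only [pre, Op.eval, Store.reg_setReg, Nat.reduceEqDiff, if_true, if_false, h2 19 (by simp),
    h19, zero_add]
  refine ⟨by simp, hN, fun r hr => ?_, fun r hr => ?_, h3⟩
  · by_cases h : r = 0
    · simp [h]
    · simp [h, h1 r hr]
  · simp only [show r ≠ 40 by omega, if_false]
    exact h2 r hr

theorem memOfList_ofFn {n : ℕ} (g : Fin n → ℤ) (f : ℕ → ℤ) (h : ∀ i : Fin n, g i = f i) (z : ℤ) :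
    memOfList (List.ofFn g) z = if 0 ≤ z ∧ z < n then f z.toNat else 0 := by
  unfold memOfList
  by_cases h0 : 0 ≤ z
  · by_cases h1 : z < n
    · have h2 : z.toNat < n := by omega
      simp [h0, h1, List.getD_eq_getElem?_getD, h2, h]
    · have h2 : ¬ z.toNat < n := by omega
      simp [h0, h1, List.getD_eq_getElem?_getD, h2]
  · simp [h0]

/-! ### Finding the best pair for two blocks -/

/-- Set the parameters for `Frag.fill`, and run it. -/
def Frag.setFill (l : List Stmt) : Frag := (Frag.basic l).seq Frag.fill

theorem Frag.Ensures.setFill {B len T : ℕ} {S J : ℤ} (d src C σ : ℤ) {s : Store} {val : ℕ → ℤ}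
    {l : List Stmt}
    (hB : 1 ≤ B) (hs : s.Bounded B) (hS : S ≠ 0) (h4 : s.reg 4 = S) (h5 : s.reg 5 = J)
    (hl : pre B (fun s₁ => (∀ r < 19, s₁.reg r = s.reg r) ∧ s₁.mem = s.mem ∧ s₁.reg 19 = d ∧
      s₁.reg 20 = src ∧ s₁.reg 21 = len ∧ s₁.reg 22 = C ∧ s₁.reg 23 = σ) l s)
    (hT : l.length + (len * 12 + 5) ≤ T)
    (haddr : ∀ i : ℕ, i < len → |d + i| ≤ B ∧ |(d + i) * S| ≤ B ∧ |(d + i) * S + J| ≤ B)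
    (hsrc : ∀ i : ℕ, i < len → |src + i| ≤ B)
    (hval : ∀ i : ℕ, i < len → ∀ mem' : ℤ → ℤ, (∀ x, (∀ z, x ≠ z * S + J) → mem' x = s.mem x) →
      |σ * mem' (src + i)| ≤ B ∧ C + σ * mem' (src + i) = val i ∧ |val i| ≤ B) :
    (Frag.setFill l).Ensures B T (fun s' => (∀ r < 19, s'.reg r = s.reg r) ∧
      (∀ z, s'.mem (z * S + J) =
        if d ≤ z ∧ z < d + len then val (z - d).toNat else s.mem (z * S + J)) ∧
      ∀ x, (∀ z, x ≠ z * S + J) → s'.mem x = s.mem x) s := by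
  refine Ensures.mono ((Ensures.basic hs le_rfl hl).seq (T' := len * 12 + 5)
    (post := fun s' => (∀ r < 19, s'.reg r = s.reg r) ∧
      (∀ z, s'.mem (z * S + J) =
        if d ≤ z ∧ z < d + len then val (z - d).toNat else s.mem (z * S + J)) ∧
      ∀ x, (∀ z, x ≠ z * S + J) → s'.mem x = s.mem x) ?_) hT fun _ _ h => h
  rintro s₁ hb₁ ⟨g1, g2, g3, g4, g5, g6, g7⟩
  refine (Ensures.fill hB hb₁ hS ((g1 4 (by simp)).trans h4) ((g1 5 (by simp)).trans h5) g3 g4 g5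
    g6 g7 haddr hsrc (val := val) (by rw [g2]; exact hval)).mono le_rfl ?_
  rintro s' - ⟨k1, k2, k3⟩
  rw [g2] at k2 k3
  exact ⟨fun r hr => by rw [k1 r (by omega), g1 r hr], k2, k3⟩

/-- Set the parameters for `Frag.locate`, run it, and copy the result. -/
def Frag.setLocate (l : List Stmt) (q : ℕ) : Frag :=
  (Frag.basic l).seq (Frag.locate.seq (Frag.basic [.const q 0, .op .add q q 34]))

theorem Frag.Ensures.setLocate {B len i₀ T q : ℕ} {S J : ℤ} (d : ℤ) {s : Store} {l : List Stmt}
    (hq : q = 24 ∨ q = 25)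
    (hB : 1 ≤ B) (hs : s.Bounded B) (h4 : s.reg 4 = S) (h5 : s.reg 5 = J)
    (hl : pre B (fun s₁ => (∀ r < 19, s₁.reg r = s.reg r) ∧ s₁.reg 24 = s.reg 24 ∧
      s₁.mem = s.mem ∧ s₁.reg 19 = d ∧ s₁.reg 21 = len) l s)
    (hT : l.length + (len * 14 + 8) ≤ T)
    (haddr : ∀ i : ℕ, i ≤ len → |d + i| ≤ B ∧ |(d + i) * S| ≤ B ∧ |(d + i) * S + J| ≤ B)
    (hi₀ : i₀ < len)
    (hval : ∀ i : ℕ, i < len →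
      (s.mem ((d + i) * S + J) - s.mem ((d + (i + 1)) * S + J)) *
        (s.mem ((d + i) * S + J) - s.mem ((d + (i + 1)) * S + J)) = if i = i₀ then 1 else 0) :
    (Frag.setLocate l q).Ensures B T (fun s' => (∀ r < 19, s'.reg r = s.reg r) ∧
      (q ≠ 24 → s'.reg 24 = s.reg 24) ∧ s'.mem = s.mem ∧ s'.reg q = i₀) s := by
  refine Ensures.mono ((Ensures.basic hs le_rfl hl).seq (T' := len * 14 + 6 + 2)
    (post := fun s' => (∀ r < 19, s'.reg r = s.reg r) ∧
      (q ≠ 24 → s'.reg 24 = s.reg 24) ∧ s'.mem = s.mem ∧ s'.reg q = i₀) ?_) hT fun _ _ h => h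
  rintro s₁ hb₁ ⟨g1, g24, g2, g3, g4⟩
  refine (Ensures.locate hB hb₁ ((g1 4 (by simp)).trans h4) ((g1 5 (by simp)).trans h5) g3 g4
    haddr hi₀ (by rw [g2]; exact hval)).seq ?_
  rintro s₂ hb₂ ⟨k1, k2, k3⟩
  refine .basic hb₂ (by simp) ?_
  have hb := hb₂.1 34
  rw [k3] at hb
  have hq34 : (34 : ℕ) ≠ q := by omega
  simp only [pre, Op.eval, Store.reg_setReg, if_true, if_neg hq34, k3, zero_add]
  refine ⟨by simp, hb, fun r hr => ?_, fun hq' => ?_, k2.trans g2, trivial⟩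
  · rw [if_neg (by omega), if_neg (by omega), k1 r (by omega), g1 r hr]
  · rw [if_neg (by omega), if_neg (by omega), k1 24 (by simp), g24]

theorem sq_sub_eq_ite_cutPositions {N : ℕ} {f : ℕ → Prop} {o : ℤ → ℤ} [DecidablePred f]
    (ho : ∀ v : ℕ, v < N → o v = if f v then 1 else 0) {p : ℕ} (hp : p + 1 < N)
    (q : Prop) [Decidable q] (hq : p ∈ cutPositions N f ↔ q) :
    (o p - o (p + 1)) * (o p - o (p + 1)) = if q then 1 else 0 := by
  have h1 := ho p (by omega)
  have h2 := ho (p + 1) hp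
  push_cast at h2
  rw [mem_cutPositions] at hq
  rw [h1, h2]
  by_cases hf : f p <;> by_cases hf' : f (p + 1) <;> simp [hf, hf', hp] at hq <;>
    simp [hf, hf', hq]

/-- Given the starting addresses `reg[16]`, `reg[17]`, `reg[18]` of sequences `a`, `b` of length
`m = reg[1]` and `c` of length `2 * m`, find `i, j < m` with `a i + b j - c (i + j)` minimal, by
means of a program `P` for minimum bisections of paths; `i` and `i + j` go to the registers `24` and
`25`. The slice `reg[5]` modulo `reg[4]` has to be empty. -/
def Frag.query (P : Program) (R : ℕ) : Frag :=
  (Frag.setFill [.const 19 0, .const 20 0, .const 27 28, .op .mul 21 27 1, .const 27 1,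
    .op .add 21 21 27, .const 27 4, .op .mul 22 27 10, .const 23 0]).seq <|
  (Frag.setFill [.const 27 3, .op .mul 19 27 1, .const 20 0, .op .add 20 20 16, .const 21 0,
    .op .add 21 21 1, .const 22 0, .op .add 22 22 10, .const 23 1]).seq <|
  (Frag.setFill [.const 27 9, .op .mul 19 27 1, .const 20 0, .op .add 20 20 18,
    .op .add 21 1 1, .const 22 0, .op .add 22 22 10, .const 23 (-1)]).seq <|
  (Frag.setFill [.const 27 20, .op .mul 19 27 1, .const 20 0, .op .add 20 20 17, .const 21 0,
    .op .add 21 21 1, .const 22 0, .op .add 22 22 10, .const 23 1]).seq <|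
  (Frag.basic [.const 27 28, .op .mul 19 27 1, .const 27 2, .op .add 19 19 27]).seq <|
  (Frag.reset R).seq <|
  (Frag.sim P).seq <|
  (Frag.setLocate [.const 27 3, .op .mul 19 27 1, .const 21 0, .op .add 21 21 1] 24).seq <|
  Frag.setLocate [.const 27 9, .op .mul 19 27 1, .op .add 21 1 1] 25

/-- Within `τ` steps and with numbers up to `b₀`, the program `P` solves the instances of size `N`
with weights up to `U`. -/
def SolvesPaths (P : Program) (N τ b₀ : ℕ) (U : ℤ) : Prop :=
  ∀ I : minBisectionOnPaths.Inst N, (∀ x ∈ minBisectionOnPaths.encode I, |x| ≤ U) →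
    ∃ t ≤ τ, Halted P ((step P)^[t] (initial N (memOfList (minBisectionOnPaths.encode I)))) ∧
      minBisectionOnPaths.Correct I
        ((step P)^[t] (initial N (memOfList (minBisectionOnPaths.encode I)))).mem ∧
      ∀ s ≤ t, ((step P)^[s] (initial N (memOfList (minBisectionOnPaths.encode I)))).Bounded b₀

theorem SolvesPaths.gadget {P : Program} {m τ b₀ : ℕ} {W X : ℤ} {a b c : ℕ → ℤ}
    (hP : SolvesPaths P (28 * m + 2) τ b₀ (4 * W)) (hm : 1 ≤ m) (hX : 0 ≤ X)
    (hW : 7 * X < W) (ha : ∀ i < m, |a i| ≤ X) (hb : ∀ i < m, |b i| ≤ X)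
    (hc : ∀ i < 2 * m, |c i| ≤ X) {mem : ℤ → ℤ}
    (hmem : ∀ z, mem z = if 0 ≤ z ∧ z < 28 * m + 1 then gadgetWeight m W a b c z.toNat else 0) :
    ∃ t ≤ τ, Halted P ((step P)^[t] (initial (28 * m + 2) mem)) ∧
      (∃ i < m, ∃ j < m, (∀ i' < m, ∀ j' < m,
        a i + b j - c (i + j) ≤ a i' + b j' - c (i' + j')) ∧
        ∀ (p : ℕ), p + 1 < 28 * m + 2 → ∀ (q : Prop) [Decidable q],
          (p ∈ ({3 * m + i, 9 * m + (i + j), 20 * m + j} : Finset ℕ) ↔ q) →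
          (((step P)^[t] (initial (28 * m + 2) mem)).mem p -
            ((step P)^[t] (initial (28 * m + 2) mem)).mem (p + 1)) *
          (((step P)^[t] (initial (28 * m + 2) mem)).mem p -
            ((step P)^[t] (initial (28 * m + 2) mem)).mem (p + 1)) = if q then 1 else 0) ∧
      ∀ s ≤ t, ((step P)^[s] (initial (28 * m + 2) mem)).Bounded b₀ := by
  classical
  have hlow := gadgetWeight_ge hX hW ha hb hc
  have hup : ∀ p, |gadgetWeight m W a b c p| ≤ 4 * W := by
    intro p
    rw [abs_of_nonneg (by linarith [hlow p])]
    unfold gadgetWeight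
    split_ifs with h1 h2 h3
    · have := abs_le.1 (ha (p - 3 * m) (by omega)); omega
    · have := abs_le.1 (hc (p - 9 * m) (by omega)); omega
    · have := abs_le.1 (hb (p - 20 * m) (by omega)); omega
    · omega
  let I : minBisectionOnPaths.Inst (28 * m + 2) :=
    ⟨fun e => gadgetWeight m W a b c (e.inf : Fin (28 * m + 2)),
      fun e _ => by linarith [hlow (e.inf : Fin (28 * m + 2))]⟩
  have hI : ∀ (p : ℕ) (h : p + 1 < 28 * m + 2),
      I.1 s(⟨p, by omega⟩, ⟨p + 1, h⟩) = gadgetWeight m W a b c p := by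
    intro p h
    change gadgetWeight m W a b c ((s(_, _) : Sym2 (Fin (28 * m + 2))).inf : Fin _) = _
    rw [Sym2.inf_mk, min_eq_left (by simp)]
  have hmemI : memOfList (minBisectionOnPaths.encode I) = mem := by
    funext z
    rw [hmem]
    refine (memOfList_ofFn _ (gadgetWeight m W a b c) (fun i => hI i (by omega)) z).trans ?_
    congr 2
  obtain ⟨t, ht, hhalt, ⟨A, hA, hout⟩, hbd⟩ := hP I (by
    intro x hx
    obtain ⟨i, rfl⟩ := List.mem_ofFn.1 hx
    rw [hI i (by omega)]
    exact hup i)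
  rw [hmemI] at hhalt hout hbd
  obtain ⟨i, hi, j, hj, hcut, hmin⟩ := gadget_minBisection hm hX hW ha hb hc hI hA
  refine ⟨t, ht, hhalt, ⟨i, hi, j, hj, hmin, fun p hp q _ hq => ?_⟩, hbd⟩
  refine sq_sub_eq_ite_cutPositions (f := fun v => ∃ h : v < 28 * m + 2, (⟨v, h⟩ : Fin _) ∈ A)
    (fun v hv => ?_) hp q (by rw [hcut]; exact hq)
  rw [hout ⟨v, hv⟩]
  simp [hv]

theorem Frag.Ensures.query {P : Program} {R B b₀ τ m : ℕ} {S J W X α β γ : ℤ} {s : Store}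
    (hR : ∀ i ∈ P, i.RegsBelow R) (hP : SolvesPaths P (28 * m + 2) τ b₀ (4 * W))
    (hm : 1 ≤ m) (hX : 0 ≤ X) (hW : 7 * X < W)
    (hB : 100 ≤ B) (hWB : 4 * W + X ≤ B) (hb₀ : b₀ ≤ B)
    (hBz : ∀ z : ℤ, |z| ≤ b₀ ∨ |z| ≤ 60 * m → |z| ≤ B ∧ |z * S| ≤ B ∧ |z * S + J| ≤ B)
    (hs : s.Bounded B) (hS : S ≠ 0) (h1 : s.reg 1 = m) (h4 : s.reg 4 = S) (h5 : s.reg 5 = J)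
    (h10 : s.reg 10 = W) (h16 : s.reg 16 = α) (h17 : s.reg 17 = β) (h18 : s.reg 18 = γ)
    (hzero : ∀ z, s.mem (z * S + J) = 0)
    (hα : ∀ i : ℕ, i < m → |α + i| ≤ B ∧ |s.mem (α + i)| ≤ X ∧ ∀ z, α + i ≠ z * S + J)
    (hβ : ∀ i : ℕ, i < m → |β + i| ≤ B ∧ |s.mem (β + i)| ≤ X ∧ ∀ z, β + i ≠ z * S + J)
    (hγ : ∀ i : ℕ, i < 2 * m → |γ + i| ≤ B ∧ |s.mem (γ + i)| ≤ X ∧ ∀ z, γ + i ≠ z * S + J) :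
    (Frag.query P R).Ensures B (500 * m + R + 3 * τ + 200) (fun s' =>
      (∀ r < 19, s'.reg r = s.reg r) ∧ (∀ x, (∀ z, x ≠ z * S + J) → s'.mem x = s.mem x) ∧
      ∃ i < m, ∃ j < m, s'.reg 24 = i ∧ s'.reg 25 = (i + j : ℕ) ∧
        ∀ i' < m, ∀ j' < m,
          s.mem (α + i) + s.mem (β + j) - s.mem (γ + (i + j : ℕ)) ≤
            s.mem (α + i') + s.mem (β + j') - s.mem (γ + (i' + j' : ℕ))) s := by
  have hB1 : 1 ≤ B := by omega
  have hBZ : (100 : ℤ) ≤ B := by exact_mod_cast hB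
  have hmz : ∀ z : ℤ, 0 ≤ z → z ≤ 60 * m → |z| ≤ B ∧ |z * S| ≤ B ∧ |z * S + J| ≤ B :=
    fun z h h' => hBz z (Or.inr (by rwa [abs_of_nonneg h]))
  have hmB : (60 : ℤ) * m ≤ B := by
    have := (hmz (60 * m) (by omega) le_rfl).1
    rwa [abs_of_nonneg (by omega)] at this
  have ab : ∀ z : ℤ, -B ≤ z → z ≤ B → |z| ≤ B := fun z h h' => abs_le.2 ⟨h, h'⟩
  have habs : ∀ z : ℤ, |z| ≤ X → |W + z| ≤ B ∧ |W - z| ≤ B := by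
    intro z hz
    have := abs_le.1 hz
    constructor <;> rw [abs_le] <;> omega
  have hαm := (hα 0 (by omega)).1
  have hβm := (hβ 0 (by omega)).1
  have hγm := (hγ 0 (by omega)).1
  rw [Nat.cast_zero, add_zero, abs_le] at hαm hβm hγm
  set a : ℕ → ℤ := fun i => s.mem (α + i) with ha
  set b : ℕ → ℤ := fun i => s.mem (β + i) with hb
  set c : ℕ → ℤ := fun i => s.mem (γ + i) with hc
  unfold Frag.query
  have hlen : 1 ≤ m := hm
  refine Ensures.mono (T := (12 * (28 * m + 1) + 20) + ((12 * m + 20) + ((24 * m + 20) +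
    ((12 * m + 20) + (4 + ((R + 2) + (3 * τ + ((14 * m + 12) + (28 * m + 12)))))))))
    (Ensures.seq (Ensures.setFill (len := 28 * m + 1) 0 0 (4 * W) 0 (val := fun _ => 4 * W)
      hB1 hs hS h4 h5 ?_ (by simp; omega) ?_ ?_ ?_) ?_) (by omega) fun _ _ h => h
  · simp only [pre, Op.eval, Store.reg_setReg, Nat.reduceEqDiff, if_true, if_false, h1, h10]
    and_intros <;> first | trivial | (apply ab <;> omega) | omega
  · intro i hi
    exact hmz _ (by omega) (by omega)
  · intro i hi
    exact (hmz _ (by omega) (by omega)).1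
  · intro i hi mem' _
    rw [zero_mul, add_zero]
    exact ⟨by simp, rfl, ab _ (by omega) (by omega)⟩
  rintro s₁ hb₁ ⟨r₁, v₁, f₁⟩
  refine Ensures.seq (Ensures.setFill (len := m) (3 * m) α W 1 (val := fun i => W + a i)
      hB1 hb₁ hS ((r₁ 4 (by simp)).trans h4) ((r₁ 5 (by simp)).trans h5)
      ?_ (by simp; omega) ?_ ?_ ?_) ?_
  · have e1 := (r₁ 1 (by simp)).trans h1
    have e10 := (r₁ 10 (by simp)).trans h10
    have e16 := (r₁ 16 (by simp)).trans h16
    simp only [pre, Op.eval, Store.reg_setReg, Nat.reduceEqDiff, if_true, if_false, zero_add, e1, e10, e16]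
    and_intros <;> first | trivial | (apply ab <;> omega) | omega
  · intro i hi
    exact hmz _ (by omega) (by omega)
  · intro i hi
    exact (hα i hi).1
  · intro i hi mem' hmem'
    rw [one_mul, hmem' _ (hα i hi).2.2, f₁ _ (hα i hi).2.2]
    have hx := (hα i hi).2.1
    exact ⟨hx.trans (by omega), rfl, (habs _ hx).1⟩
  rintro s₂ hb₂ ⟨r₂, v₂, f₂⟩
  replace r₂ : ∀ r < 19, s₂.reg r = s.reg r := fun r hr => (r₂ r hr).trans (r₁ r hr)
  replace f₂ : ∀ x, (∀ z, x ≠ z * S + J) → s₂.mem x = s.mem x :=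
    fun x hx => (f₂ x hx).trans (f₁ x hx)
  refine Ensures.seq (Ensures.setFill (len := 2 * m) (9 * m) γ W (-1) (val := fun i => W - c i)
      hB1 hb₂ hS ((r₂ 4 (by simp)).trans h4) ((r₂ 5 (by simp)).trans h5)
      ?_ (by simp; omega) ?_ ?_ ?_) ?_
  · have e1 := (r₂ 1 (by simp)).trans h1
    have e10 := (r₂ 10 (by simp)).trans h10
    have e18 := (r₂ 18 (by simp)).trans h18
    simp only [pre, Op.eval, Store.reg_setReg, Nat.reduceEqDiff, if_true, if_false, zero_add, e1, e10, e18]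
    and_intros <;> first | trivial | (apply ab <;> omega) | omega
  · intro i hi
    exact hmz _ (by omega) (by omega)
  · intro i hi
    exact (hγ i hi).1
  · intro i hi mem' hmem'
    rw [neg_one_mul, hmem' _ (hγ i hi).2.2, f₂ _ (hγ i hi).2.2, abs_neg, ← sub_eq_add_neg]
    have hx := (hγ i hi).2.1
    exact ⟨hx.trans (by omega), rfl, (habs _ hx).2⟩
  rintro s₃ hb₃ ⟨r₃, v₃, f₃⟩
  replace r₃ : ∀ r < 19, s₃.reg r = s.reg r := fun r hr => (r₃ r hr).trans (r₂ r hr)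
  replace f₃ : ∀ x, (∀ z, x ≠ z * S + J) → s₃.mem x = s.mem x :=
    fun x hx => (f₃ x hx).trans (f₂ x hx)
  refine Ensures.seq (Ensures.setFill (len := m) (20 * m) β W 1 (val := fun i => W + b i)
      hB1 hb₃ hS ((r₃ 4 (by simp)).trans h4) ((r₃ 5 (by simp)).trans h5)
      ?_ (by simp; omega) ?_ ?_ ?_) ?_
  · have e1 := (r₃ 1 (by simp)).trans h1
    have e10 := (r₃ 10 (by simp)).trans h10
    have e17 := (r₃ 17 (by simp)).trans h17
    simp only [pre, Op.eval, Store.reg_setReg, Nat.reduceEqDiff, if_true, if_false, zero_add, e1, e10, e17]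
    and_intros <;> first | trivial | (apply ab <;> omega) | omega
  · intro i hi
    exact hmz _ (by omega) (by omega)
  · intro i hi
    exact (hβ i hi).1
  · intro i hi mem' hmem'
    rw [one_mul, hmem' _ (hβ i hi).2.2, f₃ _ (hβ i hi).2.2]
    have hx := (hβ i hi).2.1
    exact ⟨hx.trans (by omega), rfl, (habs _ hx).1⟩
  rintro s₄ hb₄ ⟨r₄, v₄, f₄⟩
  replace r₄ : ∀ r < 19, s₄.reg r = s.reg r := fun r hr => (r₄ r hr).trans (r₃ r hr)
  replace f₄ : ∀ x, (∀ z, x ≠ z * S + J) → s₄.mem x = s.mem x :=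
    fun x hx => (f₄ x hx).trans (f₃ x hx)
  have hslice : ∀ z, s₄.mem (z * S + J) =
      if 0 ≤ z ∧ z < 28 * m + 1 then gadgetWeight m W a b c z.toNat else 0 := by
    intro z
    rw [v₄, v₃, v₂, v₁, hzero]
    clear v₄ v₃ v₂ v₁ f₁ f₂ f₃ f₄ r₁ r₂ r₃ r₄ hzero hα hβ hγ hBz hmz hmB habs
    by_cases hz : 0 ≤ z
    · obtain ⟨p, rfl⟩ := Int.eq_ofNat_of_zero_le hz
      unfold gadgetWeight
      rw [Int.toNat_natCast]
      push_cast
      by_cases g1 : 3 * m ≤ p ∧ p < 4 * m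
      · rw [if_neg (by omega), if_neg (by omega), if_pos (by omega), if_pos (by omega), if_pos g1,
          show ((p : ℤ) - 3 * m).toNat = p - 3 * m by omega]
      by_cases g2 : 9 * m ≤ p ∧ p < 11 * m
      · rw [if_neg (by omega), if_pos (by omega), if_pos (by omega), if_neg g1, if_pos g2,
          show ((p : ℤ) - 9 * m).toNat = p - 9 * m by omega]
      by_cases g3 : 20 * m ≤ p ∧ p < 21 * m
      · rw [if_pos (by omega), if_pos (by omega), if_neg g1, if_neg g2, if_pos g3,
          show ((p : ℤ) - 20 * m).toNat = p - 20 * m by omega]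
      rw [if_neg (by omega), if_neg (by omega), if_neg (by omega), if_neg g1, if_neg g2, if_neg g3,
        zero_add]
    · rw [if_neg (by omega), if_neg (by omega), if_neg (by omega), if_neg (by omega),
        if_neg (by omega)]
  clear v₁ v₂ v₃ v₄ f₁ f₂ f₃ r₁ r₂ r₃
  refine Ensures.seq (mid := fun s' => (∀ r < 19, s'.reg r = s.reg r) ∧ s'.mem = s₄.mem ∧
    s'.reg 19 = (28 * m + 2 : ℕ)) (Ensures.basic hb₄ (by simp) ?_) ?_
  · have e1 := (r₄ 1 (by simp)).trans h1
    simp only [pre, Op.eval, Store.reg_setReg, Nat.reduceEqDiff, if_true, if_false, e1]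
    and_intros <;> first | trivial | (apply ab <;> omega) |
      (intro r hr; split_ifs <;> first | exact r₄ r hr | omega)
  rintro s₅ hb₅ ⟨r₅, m₅, h₅⟩
  refine Ensures.seq (Ensures.reset hb₅ h₅) ?_
  rintro s₆ hb₆ ⟨p₆, r₆, m₆⟩
  replace r₆ : ∀ r < 19, s₆.reg r = s.reg r := fun r hr => (r₆ r (by omega)).trans (r₅ r hr)
  rw [m₅] at m₆
  obtain ⟨t, ht, hhalt, ⟨i, hi, j, hj, hmin, hcut⟩, hbd⟩ := hP.gadget hm hX hW
    (a := a) (b := b) (c := c) (fun i hi => (hα i hi).2.1) (fun i hi => (hβ i hi).2.1)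
    (fun i hi => (hγ i hi).2.1) (mem := fun z => s₄.mem (z * S + J)) hslice
  have e4 : s₆.reg 4 = S := (r₆ 4 (by simp)).trans h4
  have e5 : s₆.reg 5 = J := (r₆ 5 (by simp)).trans h5
  refine Ensures.seq ((Ensures.sim hR hS e4 e5 (fun z hz => (hBz z (Or.inl hz)).2) hb₀ rfl
    ⟨p₆, fun z => by rw [m₆]; rfl, fun _ _ => rfl, fun _ _ => rfl⟩ hb₆ hbd hhalt).mono
    (by omega) fun _ _ h => h) ?_
  rintro s₇ hb₇ ⟨-, v₇, r₇, f₇⟩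
  rw [m₆] at f₇
  replace f₇ : ∀ x, (∀ z, x ≠ z * S + J) → s₇.mem x = s.mem x :=
    fun x hx => (f₇ x hx).trans (f₄ x hx)
  replace r₇ : ∀ r < 19, s₇.reg r = s.reg r := fun r hr => (r₇ r (by omega)).trans (r₆ r hr)
  have e1 := (r₇ 1 (by simp)).trans h1
  refine Ensures.seq (Ensures.setLocate (len := m) (i₀ := i) (3 * m) (Or.inl rfl) hB1 hb₇
    ((r₇ 4 (by simp)).trans h4) ((r₇ 5 (by simp)).trans h5) ?_ (by simp; omega) ?_ hi ?_) ?_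
  · simp only [pre, Op.eval, Store.reg_setReg, Nat.reduceEqDiff, if_true, if_false, e1]
    and_intros <;> first | trivial | (apply ab <;> omega) | omega
  · intro i hi
    exact hmz _ (by omega) (by omega)
  · intro k hk
    rw [v₇, v₇]
    have := hcut (3 * m + k) (by omega) (k = i) (by simp; omega)
    push_cast at this
    rwa [add_assoc] at this
  rintro s₈ hb₈ ⟨r₈, -, m₈, q₈⟩
  replace r₈ : ∀ r < 19, s₈.reg r = s.reg r := fun r hr => (r₈ r (by omega)).trans (r₇ r hr)
  have e1 := (r₈ 1 (by simp)).trans h1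
  refine Ensures.mono (Ensures.setLocate (len := 2 * m) (i₀ := i + j) (9 * m) (Or.inr rfl) hB1 hb₈
    ((r₈ 4 (by simp)).trans h4) ((r₈ 5 (by simp)).trans h5) ?_ (T := 28 * m + 12)
    (by simp; omega) ?_ (by omega) ?_) le_rfl ?_
  · simp only [pre, Op.eval, Store.reg_setReg, Nat.reduceEqDiff, if_true, if_false, e1]
    and_intros <;> first | trivial | (apply ab <;> omega) | omega
  · intro i hi
    exact hmz _ (by omega) (by omega)
  · intro k hk
    rw [m₈, v₇, v₇]
    have := hcut (9 * m + k) (by omega) (k = i + j) (by simp; omega)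
    push_cast at this
    rwa [add_assoc] at this
  rintro s₉ hb₉ ⟨r₉, p₉, m₉, q₉⟩
  refine ⟨fun r hr => (r₉ r hr).trans (r₈ r hr), fun x hx => ?_, i, hi, j, hj, ?_, q₉, hmin⟩
  · rw [m₉, m₈, f₇ x hx]
  · rw [p₉ (by simp), q₈]

end WordRAM

/-! ### The search for the values of the convolution -/

/-- The values `c k` are, up to an error less than `G`, lower bounds of the entries of the
convolution of `a` and `b`, which are shifted by `2 * M`. -/
structure Approximates (q : ℕ) (M : ℤ) (a b c : ℕ → ℤ) (G : ℤ) : Prop where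
  nonneg : ∀ k < 2 * q, 0 ≤ c k
  le_bound : ∀ k < 2 * q, c k + G ≤ 4 * M + 1
  lower : ∀ i < q, ∀ j < q, c (i + j) ≤ a i + b j + 2 * M
  upper : ∀ k < q, ∃ i j, i + j = k ∧ a i + b j + 2 * M < c k + G

/-- The state of one round of the search, after the first `π` pairs of blocks: an entry of `c` is
either still the tentative lower bound `c₀ k + h`, or has been reset to `c₀ k`. -/
structure RoundState (q m : ℕ) (M : ℤ) (a b c₀ : ℕ → ℤ) (h : ℤ) (π : ℕ) (c : ℕ → ℤ) : Prop where
  cases : ∀ k < 2 * q, c k = c₀ k ∨ c k = c₀ k + h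
  reset : ∀ k < 2 * q, c k = c₀ k → ∃ i j, i + j = k ∧ a i + b j + 2 * M < c₀ k + h
  lower : ∀ π' < π, ∀ i < m, ∀ j < m, c (π' / m * m + i + (π' % m * m + j)) ≤
    a (π' / m * m + i) + b (π' % m * m + j) + 2 * M

theorem RoundState.start {q m : ℕ} {M : ℤ} {a b c₀ : ℕ → ℤ} {h : ℤ} (hh : 0 < h) :
    RoundState q m M a b c₀ h 0 (fun k => c₀ k + h) where
  cases _ _ := Or.inr rfl
  reset k _ hk := by omega
  lower π' hπ' := by omega

theorem block_lt {m π : ℕ} (hπ : π < m * m) : π / m * m + m ≤ m * m ∧ π % m * m + m ≤ m * m := by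
  have hm : 0 < m := by
    rcases Nat.eq_zero_or_pos m with rfl | h
    · simp at hπ
    · exact h
  have h1 : π / m < m := Nat.div_lt_of_lt_mul hπ
  have h2 : π % m < m := Nat.mod_lt _ hm
  constructor
  · calc π / m * m + m = (π / m + 1) * m := by ring
      _ ≤ m * m := Nat.mul_le_mul_right _ h1
  · calc π % m * m + m = (π % m + 1) * m := by ring
      _ ≤ m * m := Nat.mul_le_mul_right _ h2

theorem RoundState.next {m : ℕ} {M : ℤ} {a b c₀ c : ℕ → ℤ} {h : ℤ} {π i j : ℕ}
    (hR : RoundState (m * m) m M a b c₀ h π c)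
    (hmin : ∀ i' < m, ∀ j' < m, a (π / m * m + i) + b (π % m * m + j) -
      c (π / m * m + i + (π % m * m + j)) ≤
      a (π / m * m + i') + b (π % m * m + j') - c (π / m * m + i' + (π % m * m + j')))
    (hx : c (π / m * m + i + (π % m * m + j)) ≤
      a (π / m * m + i) + b (π % m * m + j) + 2 * M) :
    RoundState (m * m) m M a b c₀ h (π + 1) c where
  cases := hR.cases
  reset := hR.reset
  lower π' hπ' i' hi' j' hj' := by
    rcases Nat.lt_succ_iff_lt_or_eq.1 hπ' with hlt | rfl
    · exact hR.lower π' hlt i' hi' j' hj'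
    · have := hmin i' hi' j' hj'
      linarith

theorem RoundState.update {q m : ℕ} {M : ℤ} {a b c₀ c : ℕ → ℤ} {h G : ℤ} {π i j : ℕ}
    (hA : Approximates q M a b c₀ G) (hh : 0 < h)
    (hR : RoundState q m M a b c₀ h π c) (hi : i < q) (hj : j < q)
    (hx : a i + b j + 2 * M < c (i + j)) :
    c (i + j) = c₀ (i + j) + h ∧
      RoundState q m M a b c₀ h π (Function.update c (i + j) (c (i + j) - h)) := by
  have hk : c (i + j) = c₀ (i + j) + h := by
    rcases hR.cases (i + j) (by omega) with h' | h'
    · have := hA.lower i hi j hj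
      omega
    · exact h'
  refine ⟨hk, ⟨fun k hk' => ?_, fun k hk' hk'' => ?_, fun π' hπ' i' hi' j' hj' => ?_⟩⟩
  · rw [Function.update_apply]
    split_ifs with e
    · left; rw [e, hk]; ring
    · exact hR.cases k hk'
  · rw [Function.update_apply] at hk''
    split_ifs at hk'' with e
    · exact ⟨i, j, e.symm, by rw [e, ← hk]; exact hx⟩
    · exact hR.reset k hk' hk''
  · refine le_trans ?_ (hR.lower π' hπ' i' hi' j' hj')
    rw [Function.update_apply]
    split_ifs with e
    · rw [e]; omega
    · exact le_rfl

theorem RoundState.finish {m : ℕ} {M : ℤ} {a b c₀ c : ℕ → ℤ} {h G : ℤ} (hm : 1 ≤ m)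
    (hA : Approximates (m * m) M a b c₀ G) (hh : 0 < h) (hG : 2 * h ≤ G)
    (hR : RoundState (m * m) m M a b c₀ h (m * m) c) :
    Approximates (m * m) M a b c (G - h) where
  nonneg k hk := by
    have := hA.nonneg k hk
    rcases hR.cases k hk with e | e <;> rw [e] <;> omega
  le_bound k hk := by
    have := hA.le_bound k hk
    rcases hR.cases k hk with e | e <;> rw [e] <;> omega
  lower i hi j hj := by
    have hi' : i / m < m := Nat.div_lt_of_lt_mul hi
    have hj' : j / m < m := Nat.div_lt_of_lt_mul hj
    have hlt : j / m + m * (i / m) < m * m := by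
      calc j / m + m * (i / m) < m + m * (i / m) := by omega
        _ = m * (i / m + 1) := by ring
        _ ≤ m * m := Nat.mul_le_mul_left _ hi'
    have := hR.lower _ hlt (i % m) (Nat.mod_lt _ hm) (j % m) (Nat.mod_lt _ hm)
    rwa [Nat.add_mul_div_left _ _ hm, Nat.div_eq_of_lt hj', zero_add, Nat.add_mul_mod_self_left,
      Nat.mod_eq_of_lt hj', mul_comm, Nat.div_add_mod, mul_comm, Nat.div_add_mod] at this
  upper k hk := by
    rcases hR.cases k (by omega) with e | e
    · obtain ⟨i, j, hij, hlt⟩ := hR.reset k (by omega) e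
      exact ⟨i, j, hij, by omega⟩
    · obtain ⟨i, j, hij, hlt⟩ := hA.upper k hk
      exact ⟨i, j, hij, by omega⟩

open Classical in
/-- The number of entries that have not been reset. -/
noncomputable def numTentative (q : ℕ) (c₀ : ℕ → ℤ) (h : ℤ) (c : ℕ → ℤ) : ℕ :=
  ((Finset.range (2 * q)).filter fun k => c k = c₀ k + h).card

theorem numTentative_le (q : ℕ) (c₀ : ℕ → ℤ) (h : ℤ) (c : ℕ → ℤ) :
    numTentative q c₀ h c ≤ 2 * q := by
  classical
  simpa [numTentative] using Finset.card_filter_le (Finset.range (2 * q)) fun k => c k = c₀ k + h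

theorem numTentative_update {q : ℕ} {c₀ c : ℕ → ℤ} {h : ℤ} {k : ℕ} (hk : k < 2 * q) (hh : 0 < h)
    (hc : c k = c₀ k + h) :
    numTentative q c₀ h (Function.update c k (c k - h)) < numTentative q c₀ h c := by
  classical
  refine Finset.card_lt_card (Finset.ssubset_iff_of_subset ?_ |>.2 ⟨k, ?_, ?_⟩)
  · intro l
    simp only [Finset.mem_filter, Finset.mem_range, Function.update_apply]
    rintro ⟨h1, h2⟩
    refine ⟨h1, ?_⟩
    split_ifs at h2 with e
    · subst e; omega
    · exact h2
  · simp [hk, hc]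
  · simp only [Finset.mem_filter, Function.update_self]
    omega

namespace WordRAM

theorem slice_injective {S x y j j' : ℤ} (hj : 0 ≤ j) (hjS : j < S) (hj' : 0 ≤ j') (hjS' : j' < S)
    (h : x * S + j = y * S + j') : j = j' := by
  have h1 := congrArg (· % S) h
  simpa [Int.add_emod, Int.emod_eq_of_lt hj hjS, Int.emod_eq_of_lt hj' hjS'] using h1

theorem ne_slice {S x y J : ℤ} (hx : 0 ≤ x) (hxJ : x < J) (hJ : J < S) : x ≠ y * S + J := by
  intro h
  have := slice_injective (x := 0) (y := y) hx (by omega) (by omega : 0 ≤ J) hJ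
    (by rw [zero_mul, zero_add]; exact h)
  omega

/-- The sizes that are fixed during the main part of the computation. -/
structure Params where
  n : ℕ
  m : ℕ
  M : ℕ
  S : ℕ
  m_pos : 1 ≤ m
  M_pos : 1 ≤ M
  S_eq : S = n + 3 * (m * m) + 3 * (m * m) * (4 * M + 1)

/-- The layout of registers and memory in the main part of the computation: `a` starts at `0`, `b`
at `n`, `c` at `n + m * m`, and the slices from `J` on are empty. -/
structure Layout (p : Params) (a b c : ℕ → ℤ) (J : ℕ) (G : ℤ) (s : Store) : Prop where
  reg0 : s.reg 0 = p.n
  reg1 : s.reg 1 = p.m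
  reg2 : s.reg 2 = (p.m * p.m : ℕ)
  reg3 : s.reg 3 = p.M
  reg4 : s.reg 4 = p.S
  reg5 : s.reg 5 = J
  reg6 : s.reg 6 = G
  reg9 : s.reg 9 = (p.n + p.m * p.m : ℕ)
  reg10 : s.reg 10 = 32 * p.M + 32
  mem_a : ∀ i < p.m * p.m, s.mem i = a i
  mem_b : ∀ i < p.m * p.m, s.mem (p.n + i : ℕ) = b i
  mem_c : ∀ k < 2 * (p.m * p.m), s.mem (p.n + p.m * p.m + k : ℕ) = c k
  mem_zero : ∀ (z : ℤ) (j : ℕ), J ≤ j → j < p.S → s.mem (z * p.S + j) = 0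
  le_J : p.n + 3 * (p.m * p.m) ≤ J

theorem Layout.congr {p : Params} {a b c : ℕ → ℤ} {J : ℕ} {G : ℤ} {s s' : Store}
    (h : Layout p a b c J G s)
    (hr : ∀ r, r = 0 ∨ r = 1 ∨ r = 2 ∨ r = 3 ∨ r = 4 ∨ r = 5 ∨ r = 6 ∨ r = 9 ∨ r = 10 →
      s'.reg r = s.reg r) (hm : s'.mem = s.mem) : Layout p a b c J G s' where
  reg0 := (hr 0 (by simp)).trans h.reg0
  reg1 := (hr 1 (by simp)).trans h.reg1
  reg2 := (hr 2 (by simp)).trans h.reg2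
  reg3 := (hr 3 (by simp)).trans h.reg3
  reg4 := (hr 4 (by simp)).trans h.reg4
  reg5 := (hr 5 (by simp)).trans h.reg5
  reg6 := (hr 6 (by simp)).trans h.reg6
  reg9 := (hr 9 (by simp)).trans h.reg9
  reg10 := (hr 10 (by simp)).trans h.reg10
  mem_a := by rw [hm]; exact h.mem_a
  mem_b := by rw [hm]; exact h.mem_b
  mem_c := by rw [hm]; exact h.mem_c
  mem_zero := by rw [hm]; exact h.mem_zero
  le_J := h.le_J

/-- The bounds on which the analysis of the main part relies. -/
structure Bounds (p : Params) (b₀ B : ℕ) (a b : ℕ → ℤ) : Prop where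
  le_B : (b₀ + 60 * p.m + 200) * p.S ≤ B
  abs_a : ∀ i < p.m * p.m, |a i| ≤ p.M
  abs_b : ∀ i < p.m * p.m, |b i| ≤ p.M

theorem Params.le_S (p : Params) :
    p.n + 3 * (p.m * p.m) + 3 * (4 * p.M + 1) ≤ p.S ∧ p.m ≤ p.m * p.m ∧
      p.n + 6 * (p.m * p.m) ≤ p.S := by
  have h1 : 1 ≤ p.m * p.m := Nat.mul_pos p.m_pos p.m_pos
  have h2 := Nat.mul_le_mul_right (4 * p.M + 1) h1
  have h3 := Nat.mul_le_mul_left (p.m * p.m) (show 1 ≤ 4 * p.M + 1 by omega)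
  have h4 := p.S_eq
  have h5 := Nat.mul_le_mul_left p.m p.m_pos
  rw [mul_assoc] at h4
  omega

theorem Bounds.linear {p : Params} {b₀ B : ℕ} {a b : ℕ → ℤ} (h : Bounds p b₀ B a b) :
    200 * p.S ≤ B := by
  refine le_trans ?_ h.le_B
  gcongr
  omega

theorem Bounds.slice {p : Params} {b₀ B : ℕ} {a b : ℕ → ℤ} (h : Bounds p b₀ B a b) {J : ℕ}
    (hJ : J < p.S) (z : ℤ) (hz : |z| ≤ b₀ ∨ |z| ≤ 60 * p.m) :
    |z| ≤ B ∧ |z * p.S| ≤ B ∧ |z * p.S + J| ≤ B := by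
  have h1 : |z| ≤ b₀ + 60 * p.m := by
    rcases hz with hz | hz
    · exact hz.trans (by omega)
    · exact hz.trans (by omega)
  have h2 : (((b₀ + 60 * p.m + 200) * p.S : ℕ) : ℤ) ≤ B := by exact_mod_cast h.le_B
  push_cast at h2
  have hS : (1 : ℤ) ≤ p.S := by have := p.le_S; have := p.M_pos; omega
  have h3 : |z * p.S| ≤ (b₀ + 60 * p.m) * p.S := by
    rw [abs_mul, abs_of_nonneg (show (0 : ℤ) ≤ p.S by omega)]
    gcongr
  have h4 : |z| ≤ (b₀ + 60 * p.m) * p.S := by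
    calc |z| ≤ (b₀ + 60 * p.m) * 1 := by linarith
      _ ≤ _ := by gcongr
  have h5 : |(J : ℤ)| ≤ p.S := by rw [abs_of_nonneg (by omega)]; omega
  have h6 := abs_add_le (z * p.S) (J : ℤ)
  refine ⟨?_, ?_, ?_⟩ <;> nlinarith

/-- One step of the search: find the best pair in the pair number `reg[8]` of blocks; if it violates
the bound, correct that bound, otherwise go on to the next pair of blocks. -/
def Frag.searchStep (P : Program) (R : ℕ) : Frag :=
  (Frag.basic [.op .div 16 8 1, .op .mod 17 8 1, .op .mul 16 16 1, .op .mul 17 17 1,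
    .op .add 18 16 17, .op .add 18 18 9, .op .add 17 17 0]).seq <|
  (Frag.query P R).seq <|
  Frag.basic [.op .add 27 16 24, .load 27 27, .op .sub 28 25 24, .op .add 28 28 17, .load 28 28,
    .op .add 27 27 28, .op .add 27 27 3, .op .add 27 27 3, .op .add 28 18 25, .load 29 28,
    .op .sub 27 27 29, .op .div 27 27 10, .op .mul 26 27 7, .op .add 29 29 26, .store 28 29,
    .op .add 8 8 27, .const 26 1, .op .add 8 8 26, .op .add 5 5 26, .op .sub 26 2 8]

theorem Frag.Ensures.searchStep {P : Program} {R B b₀ τ : ℕ} {p : Params} {a b c : ℕ → ℤ}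
    {J π : ℕ} {G h : ℤ} {s : Store}
    (hR : ∀ i ∈ P, i.RegsBelow R)
    (hP : SolvesPaths P (28 * p.m + 2) τ b₀ (4 * (32 * p.M + 32)))
    (hb : Bounds p b₀ B a b) (hs : s.Bounded B) (hl : Layout p a b c J G s)
    (h7 : s.reg 7 = h) (h8 : s.reg 8 = π) (hπ : π < p.m * p.m) (hJ : J < p.S)
    (hh : 0 ≤ h) (hhM : h ≤ 4 * p.M + 1)
    (hc : ∀ k < 2 * (p.m * p.m), 0 ≤ c k ∧ c k ≤ 4 * p.M + 1 ∧ |c k - h| ≤ 4 * p.M + 1) :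
    (Frag.searchStep P R).Ensures B (500 * p.m + R + 3 * τ + 230) (fun s' =>
      ∃ i < p.m, ∃ j < p.m, (∀ i' < p.m, ∀ j' < p.m,
        a (π / p.m * p.m + i) + b (π % p.m * p.m + j) -
          c (π / p.m * p.m + i + (π % p.m * p.m + j)) ≤
        a (π / p.m * p.m + i') + b (π % p.m * p.m + j') -
          c (π / p.m * p.m + i' + (π % p.m * p.m + j'))) ∧
      s'.reg 7 = h ∧
      ((a (π / p.m * p.m + i) + b (π % p.m * p.m + j) + 2 * p.M <
          c (π / p.m * p.m + i + (π % p.m * p.m + j)) ∧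
        Layout p a b (Function.update c (π / p.m * p.m + i + (π % p.m * p.m + j))
          (c (π / p.m * p.m + i + (π % p.m * p.m + j)) - h)) (J + 1) G s' ∧
        s'.reg 8 = π ∧ s'.reg 26 = (p.m * p.m : ℕ) - π) ∨
      (c (π / p.m * p.m + i + (π % p.m * p.m + j)) ≤
          a (π / p.m * p.m + i) + b (π % p.m * p.m + j) + 2 * p.M ∧
        Layout p a b c (J + 1) G s' ∧
        s'.reg 8 = (π + 1 : ℕ) ∧ s'.reg 26 = (p.m * p.m : ℕ) - (π + 1 : ℕ)))) s := by
  obtain ⟨hblk₁, hblk₂⟩ := block_lt hπ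
  obtain ⟨hS₁, hS₂, hS₃⟩ := p.le_S
  have hm := p.m_pos
  have hM := p.M_pos
  have hlin := hb.linear
  have hleJ := hl.le_J
  have hdivz : (π : ℤ) / p.m = (π / p.m : ℕ) := by simp
  have hmodz : (π : ℤ) % p.m = (π % p.m : ℕ) := by simp
  have hub : π / p.m ≤ p.m * p.m := (Nat.div_le_self _ _).trans hπ.le
  have hvb : π % p.m ≤ p.m * p.m := (Nat.mod_le _ _).trans hπ.le
  have ab : ∀ z : ℤ, -B ≤ z → z ≤ B → |z| ≤ B := fun z h h' => abs_le.2 ⟨h, h'⟩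
  unfold Frag.searchStep
  set q := p.m * p.m with hq
  generalize hu' : π / p.m = u' at *
  generalize hv' : π % p.m = v' at *
  set u := u' * p.m with hu
  set v := v' * p.m with hv
  have huz : (u' : ℤ) * p.m = (u : ℕ) := by rw [hu]; push_cast; rfl
  have hvz : (v' : ℤ) * p.m = (v : ℕ) := by rw [hv]; push_cast; rfl
  refine Ensures.mono (T := 7 + ((500 * p.m + R + 3 * τ + 200) + 20)) (Ensures.seq
    (mid := fun s' => (∀ r < 16, s'.reg r = s.reg r) ∧ s'.mem = s.mem ∧ s'.reg 16 = u ∧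
      s'.reg 17 = (p.n + v : ℕ) ∧ s'.reg 18 = (p.n + q + (u + v) : ℕ))
    (Ensures.basic hs (by simp) ?_) ?_) (by omega) fun _ _ h => h
  · simp only [pre, Op.eval, Store.reg_setReg, Nat.reduceEqDiff, if_true, if_false, hl.reg0,
      hl.reg1, hl.reg9, h8, hdivz, hmodz, huz, hvz]
    and_intros <;> first | trivial | (apply ab <;> omega) | omega
  rintro s₁ hb₁ ⟨r₁, m₁, e16, e17, e18⟩
  have ea : ∀ i < p.m, s.mem ((u : ℤ) + i) = a (u + i) := fun i hi => by
    have := hl.mem_a (u + i) (by omega)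
    rwa [Nat.cast_add] at this
  have eb : ∀ i < p.m, s.mem (((p.n + v : ℕ) : ℤ) + i) = b (v + i) := fun i hi => by
    have := hl.mem_b (v + i) (by omega)
    rwa [← add_assoc, Nat.cast_add] at this
  have ec : ∀ i < 2 * p.m, s.mem (((p.n + q + (u + v) : ℕ) : ℤ) + i) = c (u + v + i) :=
    fun i hi => by
    have := hl.mem_c (u + v + i) (by omega)
    rwa [← add_assoc, Nat.cast_add] at this
  refine Ensures.seq (Ensures.query (J := J) (S := p.S) (X := 4 * p.M + 1) (m := p.m)
    (W := 32 * p.M + 32) (α := u)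
    (β := (p.n + v : ℕ)) (γ := (p.n + q + (u + v) : ℕ)) hR hP hm (by omega) (by omega) (by omega)
    (by omega) ?_ (hb.slice hJ) hb₁ (by omega) ((r₁ 1 (by simp)).trans hl.reg1)
    ((r₁ 4 (by simp)).trans hl.reg4) ((r₁ 5 (by simp)).trans hl.reg5)
    ((r₁ 10 (by simp)).trans hl.reg10) e16 e17 e18 ?_ ?_ ?_ ?_) ?_
  · refine le_trans ?_ hb.le_B
    calc b₀ ≤ (b₀ + 60 * p.m + 200) * 1 := by omega
      _ ≤ _ := by gcongr; omega
  · intro z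
    rw [m₁]
    exact hl.mem_zero z J le_rfl hJ
  · intro i hi
    rw [m₁, ea i hi]
    refine ⟨ab _ (by omega) (by omega), (hb.abs_a _ (by omega)).trans (by omega), fun z => ?_⟩
    exact ne_slice (by omega) (by omega) (by omega)
  · intro i hi
    rw [m₁, eb i hi]
    refine ⟨ab _ (by omega) (by omega), (hb.abs_b _ (by omega)).trans (by omega), fun z => ?_⟩
    exact ne_slice (by omega) (by omega) (by omega)
  · intro i hi
    rw [m₁, ec i hi]
    have := hc (u + v + i) (by omega)
    refine ⟨ab _ (by omega) (by omega), abs_le.2 ⟨by omega, by omega⟩, fun z => ?_⟩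
    exact ne_slice (by omega) (by omega) (by omega)
  rintro s₂ hb₂ ⟨r₂, f₂, i, hi, j, hj, e24, e25, hmin⟩
  rw [m₁] at f₂ hmin
  have hoff : ∀ x : ℕ, x < p.n + 3 * q → s₂.mem x = s.mem x := fun x hx =>
    f₂ _ fun z => ne_slice (by omega) (by omega) (by omega)
  have r₂' : ∀ r < 16, s₂.reg r = s.reg r := fun r hr => (r₂ r (by omega)).trans (r₁ r hr)
  have g2 := (r₂' 2 (by simp)).trans hl.reg2
  have g3 := (r₂' 3 (by simp)).trans hl.reg3
  have g5 := (r₂' 5 (by simp)).trans hl.reg5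
  have g7 := (r₂' 7 (by simp)).trans h7
  have g8 := (r₂' 8 (by simp)).trans h8
  have g10 := (r₂' 10 (by simp)).trans hl.reg10
  have g16 := (r₂ 16 (by simp)).trans e16
  have g17 := (r₂ 17 (by simp)).trans e17
  have g18 := (r₂ 18 (by simp)).trans e18
  have la : s₂.mem ((u : ℤ) + i) = a (u + i) := by
    have := hoff (u + i) (by omega)
    rw [Nat.cast_add, ea i hi] at this
    exact this
  have lb : s₂.mem (((i + j : ℕ) : ℤ) - i + (p.n + v : ℕ)) = b (v + j) := by
    have := hoff (p.n + v + j) (by omega)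
    rw [Nat.cast_add, eb j hj] at this
    rw [← this]
    congr 1
    push_cast
    ring
  have lc : s₂.mem (((p.n + q + (u + v) : ℕ) : ℤ) + (i + j : ℕ)) = c (u + i + (v + j)) := by
    have := hoff (p.n + q + (u + v) + (i + j)) (by omega)
    rw [Nat.cast_add, ec (i + j) (by omega)] at this
    rw [this]
    congr 1
    ring
  have hmin' : ∀ i' < p.m, ∀ j' < p.m, a (u + i) + b (v + j) - c (u + i + (v + j)) ≤
      a (u + i') + b (v + j') - c (u + i' + (v + j')) := by
    intro i' hi' j' hj'
    have := hmin i' hi' j' hj'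
    rw [ea i hi, eb j hj, ec _ (by omega), ea i' hi', eb j' hj', ec _ (by omega)] at this
    rwa [show u + i + (v + j) = u + v + (i + j) by ring,
      show u + i' + (v + j') = u + v + (i' + j') by ring]
  have hk : u + i + (v + j) < 2 * q := by omega
  have hck := hc _ hk
  have hab := abs_le.1 (hb.abs_a (u + i) (by omega))
  have hbb := abs_le.1 (hb.abs_b (v + j) (by omega))
  have hch := abs_le.1 hck.2.2
  have haddr : ((p.n + q + (u + v) : ℕ) : ℤ) + (i + j : ℕ) =
      (p.n + q + (u + i + (v + j)) : ℕ) := by push_cast; ring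
  rw [haddr] at lc
  have hfr : ∀ (c' : ℕ → ℤ) (y : ℤ) (s' : Store),
      (∀ r, r = 0 ∨ r = 1 ∨ r = 2 ∨ r = 3 ∨ r = 4 ∨ r = 6 ∨ r = 9 ∨ r = 10 →
        s'.reg r = s₂.reg r) → s'.reg 5 = (J + 1 : ℕ) →
      s'.mem = Function.update s₂.mem (p.n + q + (u + i + (v + j)) : ℕ) y →
      (∀ k, c' k = Function.update c (u + i + (v + j)) y k) →
      Layout p a b c' (J + 1) G s' := by
    intro c' y s' hr h5 hmem hc'
    have hr' : ∀ r, r = 0 ∨ r = 1 ∨ r = 2 ∨ r = 3 ∨ r = 4 ∨ r = 6 ∨ r = 9 ∨ r = 10 →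
      s'.reg r = s.reg r := fun r h => (hr r h).trans (r₂' r (by omega))
    refine ⟨(hr' 0 (by simp)).trans hl.reg0, (hr' 1 (by simp)).trans hl.reg1,
      (hr' 2 (by simp)).trans hl.reg2, (hr' 3 (by simp)).trans hl.reg3,
      (hr' 4 (by simp)).trans hl.reg4, h5, (hr' 6 (by simp)).trans hl.reg6,
      (hr' 9 (by simp)).trans hl.reg9, (hr' 10 (by simp)).trans hl.reg10, ?_, ?_, ?_, ?_, ?_⟩
    · intro k hk'
      rw [hmem, Function.update_of_ne (by omega), hoff k (by omega), hl.mem_a k hk']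
    · intro k hk'
      rw [hmem, Function.update_of_ne (by omega), hoff _ (by omega), hl.mem_b k hk']
    · intro k hk'
      rw [hmem, hc', Function.update_apply, Function.update_apply]
      by_cases e : k = u + i + (v + j)
      · rw [if_pos (by rw [e]), if_pos e]
      · rw [if_neg (by omega), if_neg e, hoff _ (by omega), hl.mem_c k hk']
    · intro z l hl₁ hl₂
      rw [hmem, Function.update_of_ne, f₂, hl.mem_zero z l (by omega) hl₂]
      · intro y e
        have := slice_injective (by omega) (by omega) (by omega) (by omega) e
        omega
      · exact (ne_slice (by omega) (by omega) (by omega)).symm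
    · omega
  refine Ensures.basic hb₂ (by simp) ?_
  by_cases hx : a (u + i) + b (v + j) + 2 * p.M < c (u + i + (v + j))
  · have hdiv : (a (u + i) + b (v + j) + p.M + p.M - c (u + i + (v + j))) / (32 * p.M + 32) =
        -1 := by
      rw [Int.ediv_eq_iff_of_pos (by omega)]
      constructor <;> omega
    simp only [pre, Op.eval, Store.reg_setReg, Store.reg_setMem, Store.mem_setReg,
      Nat.reduceEqDiff, if_true, if_false, g2, g3, g5, g7, g8, g10, g16, g17, g18, e24, e25, la,
      lb, lc, haddr, hdiv]
    and_intros <;> try first | trivial | (apply ab <;> omega)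
    refine ⟨i, hi, j, hj, hmin', trivial, Or.inl ⟨hx, ?_, by omega, by omega⟩⟩
    refine hfr _ (c (u + i + (v + j)) - h) _ ?_ ?_ ?_ fun k => rfl
    · rintro r (rfl | rfl | rfl | rfl | rfl | rfl | rfl | rfl) <;>
        simp [Store.reg_setReg]
    · simp [Store.reg_setReg]
    · simp only [Store.mem_setReg, Store.setMem, neg_one_mul, ← sub_eq_add_neg]
  · have hdiv : (a (u + i) + b (v + j) + p.M + p.M - c (u + i + (v + j))) / (32 * p.M + 32) =
        0 := Int.ediv_eq_zero_of_lt (by omega) (by omega)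
    simp only [pre, Op.eval, Store.reg_setReg, Store.reg_setMem, Store.mem_setReg,
      Nat.reduceEqDiff, if_true, if_false, g2, g3, g5, g7, g8, g10, g16, g17, g18, e24, e25, la,
      lb, lc, haddr, hdiv]
    and_intros <;> try first | trivial | (apply ab <;> omega)
    refine ⟨i, hi, j, hj, hmin', trivial, Or.inr ⟨not_lt.1 hx, ?_, by omega, by omega⟩⟩
    refine hfr _ (c (u + i + (v + j))) _ ?_ ?_ ?_ fun k => by rw [Function.update_eq_self]
    · rintro r (rfl | rfl | rfl | rfl | rfl | rfl | rfl | rfl) <;>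
        simp [Store.reg_setReg]
    · simp [Store.reg_setReg]
    · simp only [Store.mem_setReg, Store.setMem, zero_mul, add_zero]

theorem Layout.congr_values {p : Params} {a b c c' : ℕ → ℤ} {J : ℕ} {G : ℤ} {s : Store}
    (h : Layout p a b c J G s) (hc : ∀ k < 2 * (p.m * p.m), c k = c' k) :
    Layout p a b c' J G s :=
  { h with mem_c := fun k hk => (h.mem_c k hk).trans (hc k hk) }

theorem Layout.setReg {p : Params} {a b c : ℕ → ℤ} {J : ℕ} {G : ℤ} {s : Store}
    (h : Layout p a b c J G s) {r : ℕ} (hr : 11 ≤ r ∨ r = 7 ∨ r = 8) (v : ℤ) :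
    Layout p a b c J G (s.setReg r v) :=
  h.congr (fun q hq => by rw [Store.reg_setReg, if_neg (by omega)]) rfl

/-- Add `reg[7]` to all entries of `c`. -/
def Frag.raise : Frag :=
  .for 30 31 21 (.basic [.op .add 32 9 30, .load 33 32, .op .add 33 33 7, .store 32 33])

theorem Frag.Ensures.raise {B b₀ : ℕ} {p : Params} {a b c : ℕ → ℤ} {J : ℕ} {G h : ℤ} {s : Store}
    (hb : Bounds p b₀ B a b) (hs : s.Bounded B) (hl : Layout p a b c J G s)
    (h7 : s.reg 7 = h) (h21 : s.reg 21 = (2 * (p.m * p.m) : ℕ))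
    (hc : ∀ k < 2 * (p.m * p.m), |c k + h| ≤ 4 * p.M + 1) :
    Frag.raise.Ensures B (2 * (p.m * p.m) * 8 + 5) (fun s' =>
      Layout p a b (fun k => c k + h) J G s' ∧ s'.reg 7 = h) s := by
  obtain ⟨hS₁, hS₂, hS₃⟩ := p.le_S
  have hm := p.m_pos
  have hM := p.M_pos
  have hlin := hb.linear
  have hleJ := hl.le_J
  have ab : ∀ z : ℤ, -B ≤ z → z ≤ B → |z| ≤ B := fun z h h' => abs_le.2 ⟨h, h'⟩
  set q := p.m * p.m with hq
  refine Ensures.mono (Ensures.for (T := 4) (2 * q) (fun k s' =>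
    Layout p a b (fun l => if l < k then c l + h else c l) J G s' ∧ s'.reg 7 = h)
    (by simp) (by simp) (by simp) (by simp) (by simp) (by simp) ?_ (by omega) hs h21 ?_
    ⟨hl.congr_values (by simp), h7⟩) le_rfl ?_
  · rintro k s' v r hr ⟨h1, h2⟩
    refine ⟨h1.setReg (by omega) v, ?_⟩
    rw [Store.reg_setReg, if_neg (by omega), h2]
  · rintro k s' hb' hk ⟨h1, h2⟩ h30 h21'
    have hck := abs_le.1 (hc k hk)
    have e9 : s'.reg 9 = (p.n + q : ℕ) := h1.reg9
    have l : s'.mem (p.n + q + k : ℕ) = c k :=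
      (h1.mem_c k hk).trans (if_neg (lt_irrefl k))
    have e : ((p.n + q : ℕ) : ℤ) + k = (p.n + q + k : ℕ) := by push_cast; ring
    refine .basic hb' (by simp) ?_
    simp only [pre, Op.eval, Store.reg_setReg, Store.reg_setMem, Store.mem_setReg,
      Nat.reduceEqDiff, if_true, if_false, e9, h2, h30, e, l, h21']
    and_intros <;> try first | trivial | (apply ab <;> omega)
    have h3 := ((h1.setReg (r := 32) (by omega) (p.n + q + k : ℕ)).setReg (r := 33) (by omega)
      (c k)).setReg (r := 33) (by omega) (c k + h)
    refine ⟨h3.reg0, h3.reg1, h3.reg2, h3.reg3, h3.reg4, h3.reg5, h3.reg6, h3.reg9, h3.reg10,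
      fun i hi => ?_, fun i hi => ?_, fun l hl => ?_, fun z j hj hj' => ?_, hleJ⟩
    · rw [Store.mem_setMem, if_neg (by omega)]
      exact h3.mem_a i hi
    · rw [Store.mem_setMem, if_neg (by omega)]
      exact h3.mem_b i hi
    · rw [Store.mem_setMem]
      by_cases hkl : l = k
      · rw [if_pos (by omega), if_pos (by omega), hkl]
      · rw [if_neg (by omega), h3.mem_c l hl]
        by_cases h' : l < k
        · rw [if_pos h', if_pos (by omega)]
        · rw [if_neg h', if_neg (by omega)]
    · rw [Store.mem_setMem, if_neg (ne_slice (by omega) (by omega) (by omega)).symm]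
      exact h3.mem_zero z j hj hj'
  · rintro s' - ⟨⟨h1, h2⟩, -⟩
    exact ⟨h1.congr_values fun k hk => if_pos hk, h2⟩

/-- Halve the error of the approximations. -/
def Frag.round (P : Program) (R : ℕ) : Frag :=
  (Frag.basic [.const 27 2, .op .div 7 6 27, .op .add 21 2 2]).seq <|
  Frag.raise.seq <|
  (Frag.basic [.const 8 0, .op .sub 26 2 8]).seq <|
  (Frag.while 26 (Frag.searchStep P R)).seq <|
  Frag.basic [.op .sub 6 6 7, .const 27 1, .op .sub 27 6 27]

theorem Frag.Ensures.round {P : Program} {R B b₀ τ : ℕ} {p : Params} {a b c : ℕ → ℤ}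
    {J G : ℕ} {s : Store}
    (hR : ∀ i ∈ P, i.RegsBelow R)
    (hP : SolvesPaths P (28 * p.m + 2) τ b₀ (4 * (32 * p.M + 32)))
    (hb : Bounds p b₀ B a b) (hs : s.Bounded B) (hl : Layout p a b c J G s)
    (hA : Approximates (p.m * p.m) p.M a b c G) (hG : 2 ≤ G)
    (hJ : J + 3 * (p.m * p.m) * G ≤ p.S) :
    (Frag.round P R).Ensures B (p.m * p.m * (3 * (500 * p.m + R + 3 * τ + 230) + 50))
      (fun s' => ∃ (c' : ℕ → ℤ) (J' : ℕ), Layout p a b c' J' (G - G / 2 : ℕ) s' ∧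
        Approximates (p.m * p.m) p.M a b c' (G - G / 2 : ℕ) ∧
        J' + 3 * (p.m * p.m) * (G - G / 2) ≤ p.S ∧ s'.reg 27 = ((G - G / 2 : ℕ) : ℤ) - 1) s := by
  obtain ⟨hS₁, hS₂, hS₃⟩ := p.le_S
  have hm := p.m_pos
  have hM := p.M_pos
  have hlin := hb.linear
  have hleJ := hl.le_J
  have ab : ∀ z : ℤ, -B ≤ z → z ≤ B → |z| ≤ B := fun z h h' => abs_le.2 ⟨h, h'⟩
  have hpos : ∀ k < 2 * (p.m * p.m), 0 ≤ c k ∧ c k + G ≤ 4 * p.M + 1 :=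
    fun k hk => ⟨hA.nonneg k hk, hA.le_bound k hk⟩
  have hpos0 := hpos 0 (by omega)
  have hJ3 : J + 3 * (p.m * p.m) + 3 * (p.m * p.m) * (G - G / 2) ≤ p.S := by
    refine le_trans ?_ hJ
    have : 1 + (G - G / 2) ≤ G := by omega
    calc J + 3 * (p.m * p.m) + 3 * (p.m * p.m) * (G - G / 2) =
        J + 3 * (p.m * p.m) * (1 + (G - G / 2)) := by ring
      _ ≤ _ := by gcongr
  set q := p.m * p.m with hq
  obtain ⟨h, hh⟩ : ∃ h, h = G / 2 := ⟨_, rfl⟩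
  have hdiv : (G : ℤ) / 2 = h := by rw [hh]; simp
  rw [← hh] at hJ3 ⊢
  have hJ4 : 0 ≤ 3 * q * (G - h) := Nat.zero_le _
  refine Ensures.mono (T := 3 + ((2 * q * 8 + 5) + (2 +
    ((3 * q * ((500 * p.m + R + 3 * τ + 230) + 1) + 3) + 3)))) (Ensures.seq
    (mid := fun s' => Layout p a b c J G s' ∧ s'.reg 7 = h ∧ s'.reg 21 = (2 * q : ℕ))
    (Ensures.basic hs (by simp) ?_) ?_) ?_ fun _ _ h => h
  · simp only [pre, Op.eval, Store.reg_setReg, Nat.reduceEqDiff, if_true, if_false, hl.reg2,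
      hl.reg6, hdiv]
    and_intros <;> try first | trivial | (apply ab <;> omega) | omega
    exact ((hl.setReg (by omega) _).setReg (by omega) _).setReg (by omega) _
  · rintro s₁ hb₁ ⟨l₁, e7, e21⟩
    refine Ensures.seq (Ensures.raise hb hb₁ l₁ e7 e21 fun k hk => ?_) ?_
    · have := hpos k hk
      rw [abs_le]; omega
    rintro s₂ hb₂ ⟨l₂, g7⟩
    refine Ensures.seq (mid := fun s' => Layout p a b (fun k => c k + h) J G s' ∧ s'.reg 7 = h ∧
      s'.reg 8 = 0 ∧ s'.reg 26 = q) (Ensures.basic hb₂ (by simp) ?_) ?_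
    · simp only [pre, Op.eval, Store.reg_setReg, Nat.reduceEqDiff, if_true, if_false, l₂.reg2, g7]
      and_intros <;> try first | trivial | (apply ab <;> omega) | omega
      exact (l₂.setReg (by omega) _).setReg (by omega) _
    rintro s₃ hb₃ ⟨l₃, k7, k8, k26⟩
    have hhpos : (0 : ℤ) < h := by omega
    refine Ensures.seq (Ensures.while (K := 3 * q) (T := 500 * p.m + R + 3 * τ + 230)
      (fun μ s' => ∃ (π J' : ℕ) (c' : ℕ → ℤ), π ≤ q ∧ RoundState q p.m p.M a b c h π c' ∧
        Layout p a b c' J' G s' ∧ μ = (q - π) + numTentative q c h c' ∧ J' + μ ≤ J + 3 * q ∧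
        s'.reg 7 = h ∧ s'.reg 8 = π ∧ s'.reg 26 = (q : ℕ) - (π : ℕ)) (by omega) ?_ hb₃ ?_) ?_
    · rintro μ s' hb' ⟨π, J', c', hπ, hRS, hl', hμ, hJ', f7, f8, f26⟩ hx
      rw [f26] at hx
      have hπ' : π < q := by omega
      obtain ⟨hblk₁, hblk₂⟩ := block_lt hπ'
      refine Ensures.mono (Ensures.searchStep hR hP hb hb' hl' f7 f8 hπ' (by omega) (by omega)
        (by omega) fun k hk => ?_) le_rfl ?_
      · have := hpos k hk
        rcases hRS.cases k hk with e | e <;> rw [e, abs_le] <;> omega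
      · rintro s'' - ⟨i, hi, j, hj, hmin, d7, (⟨hlt, hl'', d8, d26⟩ | ⟨hle, hl'', d8, d26⟩)⟩
        · obtain ⟨hk, hRS'⟩ := hRS.update hA hhpos (by omega) (by omega) hlt
          have hnum := numTentative_update (q := q) (c₀ := c) (by omega) hhpos hk
          refine ⟨_, ?_, π, J' + 1, _, hπ, hRS', hl'', rfl, by omega, d7, d8, d26⟩
          omega
        · refine ⟨_, ?_, π + 1, J' + 1, _, hπ', hRS.next hmin hle, hl'', rfl, by omega, d7, d8,
            d26⟩
          omega
    · have hnum := numTentative_le q c h (fun k => c k + h)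
      have hnum' : numTentative q c h (fun k => c k + h) = 2 * q := by
        simp [numTentative]
      refine ⟨0, J, _, by omega, RoundState.start hhpos, l₃.setReg (by omega) 1, ?_, by omega,
        ?_, ?_, ?_⟩
      · omega
      all_goals simp [Store.reg_setReg, k7, k8, k26]
    · rintro s₄ hb₄ ⟨hneg, μ, hμK, π, J', c', hπ, hRS, hl', hμ, hJ', f7, f8, f26⟩
      rw [f26] at hneg
      obtain rfl : π = q := by omega
      refine Ensures.basic hb₄ (by simp) ?_
      have hGh : (G : ℤ) - h = (G - h : ℕ) := by omega
      simp only [pre, Op.eval, Store.reg_setReg, Nat.reduceEqDiff, if_true, if_false, hl'.reg6,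
        f7, hGh]
      and_intros <;> try first | trivial | (apply ab <;> omega) | omega
      refine ⟨c', J', ?_, ?_, by omega, trivial⟩
      · refine Layout.setReg (Layout.setReg ?_ (by omega) _) (by omega) _
        refine ⟨hl'.reg0, hl'.reg1, hl'.reg2, hl'.reg3, hl'.reg4, hl'.reg5, ?_, hl'.reg9,
          hl'.reg10, hl'.mem_a, hl'.mem_b, hl'.mem_c, hl'.mem_zero, hl'.le_J⟩
        simp [Store.reg_setReg]
      · rw [← hGh]
        exact hRS.finish hm hA hhpos (by omega)
  · have hq1 : 1 ≤ q := Nat.mul_pos hm hm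
    nlinarith

/-- Refine the approximations until they are exact. -/
def Frag.search (P : Program) (R : ℕ) : Frag := Frag.while 27 (Frag.round P R)

theorem Frag.Ensures.search {P : Program} {R B b₀ τ : ℕ} {p : Params} {a b c : ℕ → ℤ}
    {J G : ℕ} {s : Store}
    (hR : ∀ i ∈ P, i.RegsBelow R)
    (hP : SolvesPaths P (28 * p.m + 2) τ b₀ (4 * (32 * p.M + 32)))
    (hb : Bounds p b₀ B a b) (hs : s.Bounded B) (hl : Layout p a b c J G s)
    (hA : Approximates (p.m * p.m) p.M a b c G) (hG : 1 ≤ G)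
    (hJ : J + 3 * (p.m * p.m) * G ≤ p.S) (h27 : s.reg 27 = G - 1) :
    (Frag.search P R).Ensures B
      (Nat.clog 2 G * (p.m * p.m * (3 * (500 * p.m + R + 3 * τ + 230) + 50) + 1) + 3)
      (fun s' => ∃ (c' : ℕ → ℤ) (J' : ℕ), Layout p a b c' J' 1 s' ∧
        Approximates (p.m * p.m) p.M a b c' 1) s := by
  obtain ⟨hS₁, hS₂, hS₃⟩ := p.le_S
  have hlin := hb.linear
  refine Ensures.mono (Ensures.while (fun k s' => ∃ (G' : ℕ) (c' : ℕ → ℤ) (J' : ℕ),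
    k = Nat.clog 2 G' ∧ 1 ≤ G' ∧ Layout p a b c' J' G' s' ∧
    Approximates (p.m * p.m) p.M a b c' G' ∧ J' + 3 * (p.m * p.m) * G' ≤ p.S ∧
    s'.reg 27 = G' - 1) (by omega) ?_ hs
    ⟨G, c, J, rfl, hG, hl.setReg (by omega) 1, hA, hJ, by simp [Store.reg_setReg, h27]⟩) le_rfl ?_
  · rintro k s' hb' ⟨G', c', J', rfl, hG', hl', hA', hJ', h27'⟩ hpos
    rw [h27'] at hpos
    refine Ensures.mono (Ensures.round hR hP hb hb' hl' hA' (by omega) hJ') le_rfl ?_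
    rintro s'' - ⟨c'', J'', hl'', hA'', hJ'', h27''⟩
    refine ⟨_, ?_, G' - G' / 2, c'', J'', rfl, by omega, hl'', hA'', hJ'', h27''⟩
    rw [Nat.clog_of_two_le (by omega) (by omega : 2 ≤ G'),
      show (G' + 2 - 1) / 2 = G' - G' / 2 by omega]
    omega
  · rintro s' - ⟨hneg, k, -, G', c', J', -, hG', hl', hA', -, h27'⟩
    rw [h27'] at hneg
    obtain rfl : G' = 1 := by omega
    exact ⟨c', J', by simpa using hl', by simpa using hA'⟩

/-- Compute in register `1` the least `m` with `reg[0] ≤ m * m`. -/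
def Frag.sqrt : Frag :=
  (Frag.basic [.const 1 0, .const 11 0, .op .add 11 11 0]).seq <|
  .while 11 (.basic [.const 12 1, .op .add 1 1 12, .op .mul 12 1 1, .op .sub 11 0 12])

theorem Frag.Ensures.sqrt {B n m : ℕ} {s : Store} (hs : s.Bounded B) (hn : s.reg 0 = n)
    (hm : n ≤ m * m) (hm' : (m - 1) * (m - 1) < n) (hB : n + m * m + 1 ≤ B) :
    Frag.sqrt.Ensures B (5 * m + 6) (fun s' => s'.reg 0 = n ∧ s'.reg 1 = m ∧ s'.mem = s.mem) s := by
  have ab : ∀ z : ℤ, -B ≤ z → z ≤ B → |z| ≤ B := fun z h h' => abs_le.2 ⟨h, h'⟩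
  refine Ensures.mono (T := 3 + (m * (4 + 1) + 3)) (Ensures.seq
    (mid := fun s' => s'.reg 0 = n ∧ s'.reg 1 = 0 ∧ s'.reg 11 = n ∧ s'.mem = s.mem)
    (Ensures.basic hs (by simp) ?_) ?_) (by omega) fun _ _ h => h
  · simp only [pre, Op.eval, Store.reg_setReg, Nat.reduceEqDiff, if_true, if_false, hn,
      OfNat.zero_ne_ofNat, zero_ne_one, zero_add, OfNat.one_ne_ofNat]
    and_intros <;> first | trivial | (apply ab <;> omega)
  rintro s₁ hb₁ ⟨h0, h1, h11, hmem⟩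
  refine Ensures.mono (Ensures.while (fun k s' => ∃ l : ℕ, k + l = m ∧ s'.reg 0 = n ∧
    s'.reg 1 = l ∧ s'.reg 11 = n - (l * l : ℕ) ∧ s'.mem = s.mem) (by omega) ?_ hb₁
    ⟨0, rfl, by simp [Store.reg_setReg, h0], by simp [Store.reg_setReg, h1],
      by simp [Store.reg_setReg, h11], hmem⟩) le_rfl ?_
  · rintro k s' hb' ⟨l, hl, g0, g1, g11, hmem'⟩ hpos
    rw [g11] at hpos
    have hlm : l < m := by
      by_contra hle
      have := Nat.mul_le_mul (not_lt.1 hle) (not_lt.1 hle)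
      omega
    have hsq := Nat.mul_le_mul hlm hlm
    have hle := Nat.le_mul_self (l + 1)
    have e1 : (l : ℤ) + 1 = (l + 1 : ℕ) := by push_cast; rfl
    have e2 : ((l + 1 : ℕ) : ℤ) * (l + 1 : ℕ) = ((l + 1) * (l + 1) : ℕ) := by push_cast; rfl
    refine Ensures.basic hb' (by simp) ?_
    simp only [pre, Op.eval, Store.reg_setReg, Nat.reduceEqDiff, if_true, if_false, g0, g1,
      OfNat.zero_ne_ofNat, zero_ne_one, OfNat.one_ne_ofNat, e1, e2]
    simp only [Nat.succ_eq_add_one] at hsq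
    and_intros <;> try first | trivial | (apply ab <;> omega)
    exact ⟨k - 1, by omega, l + 1, by omega, trivial, rfl, rfl, hmem'⟩
  · rintro s' - ⟨hneg, k, -, l, hl, g0, g1, g11, hmem'⟩
    rw [g11] at hneg
    have : m ≤ l := by
      by_contra hlt
      have := Nat.mul_le_mul (show l ≤ m - 1 by omega) (show l ≤ m - 1 by omega)
      omega
    obtain rfl : l = m := by omega
    exact ⟨g0, g1, hmem'⟩

/-- Compute in register `3` the number `1 + ∑ i < 2 * reg[0], mem[i] ^ 2`. -/
def Frag.sumSq : Frag :=
  (Frag.basic [.op .mul 2 1 1, .const 3 1, .op .add 21 0 0]).seq <|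
  .for 30 31 21 (.basic [.load 32 30, .op .mul 32 32 32, .op .add 3 3 32])

theorem Frag.Ensures.sumSq {B n m M : ℕ} {s : Store} (hs : s.Bounded B) (h0 : s.reg 0 = n)
    (h1 : s.reg 1 = m) (hM : (M : ℤ) = 1 + ∑ i ∈ Finset.range (2 * n), s.mem i * s.mem i)
    (hB : 2 * n + m * m + M + 1 ≤ B) :
    Frag.sumSq.Ensures B (14 * n + 8) (fun s' => s'.reg 0 = n ∧ s'.reg 1 = m ∧
      s'.reg 2 = (m * m : ℕ) ∧ s'.reg 3 = M ∧ s'.mem = s.mem) s := by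
  have ab : ∀ z : ℤ, -B ≤ z → z ≤ B → |z| ≤ B := fun z h h' => abs_le.2 ⟨h, h'⟩
  have e2 : (m : ℤ) * m = (m * m : ℕ) := by push_cast; rfl
  refine Ensures.mono (T := 3 + (2 * n * (3 + 4) + 5)) (Ensures.seq
    (mid := fun s' => s'.reg 0 = n ∧ s'.reg 1 = m ∧ s'.reg 2 = (m * m : ℕ) ∧ s'.reg 3 = 1 ∧
      s'.reg 21 = (2 * n : ℕ) ∧ s'.mem = s.mem)
    (Ensures.basic hs (by simp) ?_) ?_) (by omega) fun _ _ h => h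
  · simp only [pre, Op.eval, Store.reg_setReg, Nat.reduceEqDiff, if_true, if_false, h0, h1, e2,
      OfNat.zero_ne_ofNat, OfNat.one_ne_ofNat]
    and_intros <;> first | trivial | (apply ab <;> omega) | omega
  rintro s₁ hb₁ ⟨g0, g1, g2, g3, g21, hmem⟩
  refine Ensures.mono (Ensures.for (2 * n) (fun k s' => s'.reg 0 = n ∧ s'.reg 1 = m ∧
    s'.reg 2 = (m * m : ℕ) ∧ s'.reg 3 = 1 + ∑ i ∈ Finset.range k, s.mem i * s.mem i ∧
    s'.mem = s.mem)
    (by simp) (by simp) (by simp) (by simp) (by simp) (by simp) ?_ (by omega) hb₁ g21 ?_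
    ⟨g0, g1, g2, by simp [g3], hmem⟩) le_rfl ?_
  · rintro k s' v r hr ⟨k0, k1, k2, k3, hmem'⟩
    refine ⟨?_, ?_, ?_, ?_, hmem'⟩ <;> rw [Store.reg_setReg, if_neg (by omega)] <;> assumption
  · rintro k s' hb' hk ⟨k0, k1, k2, k3, hmem'⟩ h30 h21
    have hnn : ∀ i : ℕ, 0 ≤ s.mem i * s.mem i := fun i => mul_self_nonneg _
    have hle : ∑ i ∈ Finset.range (k + 1), s.mem i * s.mem i ≤ M - 1 := by
      rw [hM, add_sub_cancel_left]
      exact Finset.sum_le_sum_of_subset_of_nonneg (Finset.range_mono (by omega)) fun i _ _ => hnn i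
    have hpos := Finset.sum_nonneg (s := Finset.range k) fun i _ => hnn i
    rw [Finset.sum_range_succ] at hle
    have hk0 := hnn k
    refine Ensures.basic hb' (by simp) ?_
    simp only [pre, Op.eval, Store.reg_setReg, Store.mem_setReg, Nat.reduceEqDiff, if_true,
      if_false, k0, k1, k2, k3, h30, h21, hmem', OfNat.zero_ne_ofNat, OfNat.one_ne_ofNat,
      Finset.sum_range_succ]
    and_intros <;> first | trivial | (apply ab <;> omega) | omega
  · rintro s' - ⟨⟨k0, k1, k2, k3, hmem'⟩, -⟩
    exact ⟨k0, k1, k2, by rw [k3, hM], hmem'⟩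

/-- Compute the parameters of the search. -/
def Frag.setup : Frag :=
  Frag.sqrt.seq <| Frag.sumSq.seq <| Frag.basic
    [.op .add 9 0 2, .const 27 4, .op .mul 6 3 27, .const 27 1, .op .add 6 6 27, .const 27 3,
      .op .mul 27 27 2, .op .add 5 0 27, .op .mul 27 27 6, .op .add 4 5 27, .const 27 32,
      .op .mul 10 27 3, .op .add 10 10 27, .const 28 1, .op .sub 27 6 28]

/-- Write the first values to the beginning of the memory. -/
def Frag.output : Frag :=
  .for 30 31 0 (.basic [.op .add 32 9 30, .load 33 32, .op .sub 33 33 3, .op .sub 33 33 3,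
    .store 30 33])

theorem Frag.Ensures.setup {b₀ B : ℕ} {p : Params} {a b : ℕ → ℤ} {s : Store}
    (hb : Bounds p b₀ B a b) (hs : s.Bounded B) (h0 : s.reg 0 = p.n)
    (hm : p.n ≤ p.m * p.m) (hm' : (p.m - 1) * (p.m - 1) < p.n)
    (hM : (p.M : ℤ) = 1 + ∑ i ∈ Finset.range (2 * p.n), s.mem i * s.mem i)
    (ha : ∀ i < p.m * p.m, s.mem i = a i) (hb' : ∀ i < p.m * p.m, s.mem (p.n + i : ℕ) = b i)
    (hmem : ∀ x : ℤ, x < 0 ∨ 2 * p.n ≤ x → s.mem x = 0) :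
    Frag.setup.Ensures B (5 * p.m + 14 * p.n + 29) (fun s' =>
      Layout p a b (fun _ => 0) (p.n + 3 * (p.m * p.m)) (4 * p.M + 1 : ℕ) s' ∧
        s'.reg 27 = (4 * p.M + 1 : ℕ) - 1) s := by
  obtain ⟨hS₁, hS₂, hS₃⟩ := p.le_S
  have hlin := hb.linear
  have hSeq := p.S_eq
  have ab : ∀ z : ℤ, -B ≤ z → z ≤ B → |z| ≤ B := fun z h h' => abs_le.2 ⟨h, h'⟩
  refine Ensures.mono (T := (5 * p.m + 6) + ((14 * p.n + 8) + 15))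
    (Ensures.seq (Ensures.sqrt hs h0 hm hm' (by omega)) ?_) (by omega) fun _ _ h => h
  rintro s₁ hb₁ ⟨f0, f1, fm⟩
  refine Ensures.seq (Ensures.sumSq hb₁ f0 f1 (by rw [fm]; exact hM) (by omega)) ?_
  rintro s₂ hb₂ ⟨g0, g1, g2, g3, gm⟩
  rw [fm] at gm
  refine Ensures.basic hb₂ (by simp) ?_
  have e1 : 3 * ((p.m * p.m : ℕ) : ℤ) = (3 * (p.m * p.m) : ℕ) := by push_cast; rfl
  have e2 : (p.M : ℤ) * 4 + 1 = (4 * p.M + 1 : ℕ) := by push_cast; ring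
  have e3 : ((3 * (p.m * p.m) : ℕ) : ℤ) * (4 * p.M + 1 : ℕ) =
    (3 * (p.m * p.m) * (4 * p.M + 1) : ℕ) := by push_cast; rfl
  simp only [pre, Op.eval, Store.reg_setReg, Nat.reduceEqDiff, if_true, if_false, g0, g2, g3,
    OfNat.zero_ne_ofNat, e1, e2, e3]
  and_intros <;> try first | trivial | (apply ab <;> omega)
  refine ⟨?_, ?_, ?_, ?_, ?_, ?_, ?_, ?_, ?_, ?_, ?_, ?_, ?_, le_rfl⟩
  · simp [Store.reg_setReg, g0]
  · simp [Store.reg_setReg, g1]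
  · simp [Store.reg_setReg, g2]
  · simp [Store.reg_setReg, g3]
  · simp only [Store.reg_setReg, Nat.reduceEqDiff, if_true, if_false]
    rw [hSeq]; push_cast; ring
  · simp only [Store.reg_setReg, Nat.reduceEqDiff, if_true, if_false]
    push_cast; ring
  · simp only [Store.reg_setReg, Nat.reduceEqDiff, if_true, if_false]
  · simp only [Store.reg_setReg, Nat.reduceEqDiff, if_true, if_false]
    push_cast; ring
  · simp only [Store.reg_setReg, Nat.reduceEqDiff, if_true, if_false]
  · intro i hi
    simp only [Store.mem_setReg, gm]
    exact ha i hi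
  · intro i hi
    simp only [Store.mem_setReg, gm]
    exact hb' i hi
  · intro i hi
    simp only [Store.mem_setReg, gm]
    exact hmem _ (by omega)
  · intro z j hj hj'
    simp only [Store.mem_setReg, gm]
    apply hmem
    by_contra hx
    exact ne_slice (x := z * p.S + j) (y := z) (J := j) (by omega) (by omega) (by omega) rfl

theorem Frag.Ensures.output {b₀ B : ℕ} {p : Params} {a b c : ℕ → ℤ} {J : ℕ} {G : ℤ} {s : Store}
    (hb : Bounds p b₀ B a b) (hs : s.Bounded B) (hl : Layout p a b c J G s)
    (hm : p.n ≤ p.m * p.m) (hc : ∀ k < 2 * (p.m * p.m), 0 ≤ c k ∧ c k ≤ 4 * p.M + 1) :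
    Frag.output.Ensures B (9 * p.n + 5) (fun s' => ∀ k < p.n, s'.mem (k : ℕ) = c k - 2 * p.M) s := by
  obtain ⟨hS₁, hS₂, hS₃⟩ := p.le_S
  have hlin := hb.linear
  have ab : ∀ z : ℤ, -B ≤ z → z ≤ B → |z| ≤ B := fun z h h' => abs_le.2 ⟨h, h'⟩
  refine Ensures.mono (Ensures.for (T := 5) p.n (fun k s' =>
    (s'.reg 3 = p.M ∧ s'.reg 9 = (p.n + p.m * p.m : ℕ)) ∧
    (∀ l < p.n, s'.mem (p.n + p.m * p.m + l : ℕ) = c l) ∧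
    ∀ l < k, s'.mem (l : ℕ) = c l - 2 * p.M)
    (by simp) (by simp) (by simp) (by simp) (by simp) (by simp) ?_ (by omega) hs hl.reg0 ?_
    ⟨⟨hl.reg3, hl.reg9⟩, fun l hl' => hl.mem_c l (by omega), by simp⟩) (by omega) ?_
  · rintro k s' v r hr ⟨⟨h1, h2⟩, h3⟩
    refine ⟨⟨?_, ?_⟩, h3⟩ <;> rw [Store.reg_setReg, if_neg (by omega)] <;> assumption
  · rintro k s' hb' hk ⟨⟨h3, h9⟩, h1, h2⟩ h30 h0
    have hck := hc k (by omega)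
    have l := h1 k hk
    have e : ((p.n + p.m * p.m : ℕ) : ℤ) + k = (p.n + p.m * p.m + k : ℕ) := by push_cast; ring
    refine Ensures.basic hb' (by simp) ?_
    simp only [pre, Op.eval, Store.reg_setReg, Store.reg_setMem, Store.mem_setReg,
      Nat.reduceEqDiff, if_true, if_false, h3, h9, h30, h0, e, l, OfNat.zero_ne_ofNat]
    and_intros <;> try first | trivial | (apply ab <;> omega)
    · intro l hl
      rw [Store.mem_setMem, if_neg (by omega)]
      exact h1 l hl
    · intro l hl
      rw [Store.mem_setMem]
      split_ifs with hlk
      · obtain rfl : l = k := by omega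
        ring
      · exact h2 l (by omega)
  · rintro s' - ⟨⟨-, -, h⟩, -⟩
    exact h

/-- The program for `(min, +)`-convolution on the basis of a program `P` for minimum bisections of
paths. -/
def Frag.convolution (P : Program) (R : ℕ) : Frag :=
  Frag.setup.seq ((Frag.search P R).seq Frag.output)

theorem Frag.Ensures.convolution {P : Program} {R B b₀ τ : ℕ} {p : Params} {a b : ℕ → ℤ}
    {s : Store} (hR : ∀ i ∈ P, i.RegsBelow R)
    (hP : SolvesPaths P (28 * p.m + 2) τ b₀ (4 * (32 * p.M + 32)))
    (hb : Bounds p b₀ B a b) (hs : s.Bounded B) (h0 : s.reg 0 = p.n)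
    (hm : p.n ≤ p.m * p.m) (hm' : (p.m - 1) * (p.m - 1) < p.n)
    (hM : (p.M : ℤ) = 1 + ∑ i ∈ Finset.range (2 * p.n), s.mem i * s.mem i)
    (ha : ∀ i < p.m * p.m, s.mem i = a i) (hb' : ∀ i < p.m * p.m, s.mem (p.n + i : ℕ) = b i)
    (hmem : ∀ x : ℤ, x < 0 ∨ 2 * p.n ≤ x → s.mem x = 0) :
    (Frag.convolution P R).Ensures B ((5 * p.m + 14 * p.n + 29) +
      ((Nat.clog 2 (4 * p.M + 1) *
        (p.m * p.m * (3 * (500 * p.m + R + 3 * τ + 230) + 50) + 1) + 3) + (9 * p.n + 5)))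
      (fun s' => ∀ k < p.n, (∀ i j, i + j = k → s'.mem (k : ℕ) ≤ a i + b j) ∧
        ∃ i j, i + j = k ∧ s'.mem (k : ℕ) = a i + b j) s := by
  have hm1 := p.m_pos
  refine Ensures.seq (Ensures.setup hb hs h0 hm hm' hM ha hb' hmem) ?_
  rintro s₁ hb₁ ⟨l₁, h27⟩
  refine Ensures.seq (Ensures.search hR hP hb hb₁ l₁ ?_ (by omega) p.S_eq.ge h27) ?_
  · refine ⟨fun _ _ => le_rfl, fun _ _ => by simp, fun i hi j hj => ?_, fun k hk => ?_⟩
    · have h1 := abs_le.1 (hb.abs_a i hi)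
      have h2 := abs_le.1 (hb.abs_b j hj)
      omega
    · refine ⟨0, k, by omega, ?_⟩
      have h1 := abs_le.1 (hb.abs_a 0 (by omega))
      have h2 := abs_le.1 (hb.abs_b k hk)
      push_cast
      omega
  rintro s₂ hb₂ ⟨c, J, l₂, hA⟩
  refine Ensures.mono (Ensures.output hb hb₂ l₂ hm fun k hk => ⟨hA.nonneg k hk, ?_⟩) le_rfl ?_
  · have := hA.le_bound k hk
    omega
  · intro s' _ h k hk
    have hlow : ∀ i j, i + j = k → c k ≤ a i + b j + 2 * p.M := by
      rintro i j rfl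
      exact hA.lower i (by omega) j (by omega)
    rw [h k hk]
    refine ⟨fun i j hij => by have := hlow i j hij; omega, ?_⟩
    obtain ⟨i, j, hij, hlt⟩ := hA.upper k (by omega)
    exact ⟨i, j, hij, by have := hlow i j hij; omega⟩

end WordRAM

theorem exists_clog_le_rpow {η : ℝ} (hη : 0 < η) :
    ∃ E : ℝ, 0 ≤ E ∧ ∀ n : ℕ, 1 ≤ n → (Nat.clog 2 n : ℝ) ≤ E * (n : ℝ) ^ η := by
  have hlog2 : 0 < Real.log 2 := Real.log_pos (by norm_num)
  refine ⟨1 / η / Real.log 2 + 1, by positivity, fun n hn => ?_⟩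
  have hn' : (1 : ℝ) ≤ n := by exact_mod_cast hn
  have h1 : Nat.clog 2 n ≤ Nat.log 2 n + 1 :=
    Nat.clog_le_of_le_pow (Nat.lt_pow_succ_log_self (by norm_num) n).le
  have h2 : (Nat.log 2 n : ℝ) * Real.log 2 ≤ (n : ℝ) ^ η / η := by
    refine le_trans ?_ (Real.log_le_rpow_div (by positivity) hη)
    rw [← Real.log_pow]
    refine Real.log_le_log (by positivity) ?_
    exact_mod_cast Nat.pow_log_le_self 2 (by omega)
  have h3 : (1 : ℝ) ≤ (n : ℝ) ^ η := Real.one_le_rpow hn' hη.le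
  have h4 : (Nat.log 2 n : ℝ) ≤ 1 / η / Real.log 2 * (n : ℝ) ^ η := by
    rw [← le_div_iff₀ hlog2] at h2
    exact h2.trans_eq (by ring)
  have h5 : (Nat.clog 2 n : ℝ) ≤ Nat.log 2 n + 1 := by exact_mod_cast h1
  linarith

theorem exists_time_bound {ε : ℝ} (hε : 0 < ε) (hε1 : ε ≤ 1) (A R d : ℕ) :
    ∃ C : ℕ, ∀ n m M τ : ℕ, 1 ≤ n → 1 ≤ m → m * m ≤ 4 * n → 4 * M + 1 ≤ 16 * n ^ (2 * d + 1) →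
      (τ : ℝ) ≤ A * ((28 * m + 2 : ℕ) : ℝ) ^ (2 - ε) →
      (((5 * m + 14 * n + 29) + ((Nat.clog 2 (4 * M + 1) *
        (m * m * (3 * (500 * m + R + 3 * τ + 230) + 50) + 1) + 3) + (9 * n + 5)) : ℕ) : ℝ) ≤
        C * (n : ℝ) ^ (2 - ε / 4) := by
  obtain ⟨E, hE, hclog⟩ := exists_clog_le_rpow (show 0 < ε / 4 by positivity)
  set D : ℝ := 3 * (1000 + R + 3 * (3600 * A) + 230) + 50 with hD
  obtain ⟨C, hC⟩ := exists_nat_ge (70 + (4 + (2 * d + 1) * E) * (4 * D + 1))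
  refine ⟨C, fun n m M τ hn hm hmn hM hτ => ?_⟩
  have hn' : (1 : ℝ) ≤ n := by exact_mod_cast hn
  have hn0 : (0 : ℝ) < n := by linarith
  have hmn' : (m : ℝ) * m ≤ 4 * n := by exact_mod_cast hmn
  have hm' : (1 : ℝ) ≤ m := by exact_mod_cast hm
  have hsq : ((n : ℝ) ^ (1 / 2 : ℝ)) * (n : ℝ) ^ (1 / 2 : ℝ) = n := by
    rw [← Real.rpow_add hn0]; norm_num
  set r : ℝ := (n : ℝ) ^ (1 / 2 : ℝ) with hr
  have hr0 : 0 ≤ r := by positivity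
  have hmr : (m : ℝ) ≤ 2 * r := by nlinarith
  set y : ℝ := (n : ℝ) ^ (1 - ε / 2) with hy
  have hry : r ≤ y := Real.rpow_le_rpow_of_exponent_le hn' (by linarith)
  have hy1 : 1 ≤ y := Real.one_le_rpow hn' (by linarith)
  have hN : ((28 * m + 2 : ℕ) : ℝ) ^ (2 - ε) ≤ 3600 * y := by
    have h1 : ((28 * m + 2 : ℕ) : ℝ) ≤ 60 * r := by push_cast; linarith
    calc ((28 * m + 2 : ℕ) : ℝ) ^ (2 - ε) ≤ (60 * r) ^ (2 - ε) :=
          Real.rpow_le_rpow (by positivity) h1 (by linarith)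
      _ = 60 ^ (2 - ε) * y := by
          rw [Real.mul_rpow (by norm_num) hr0, hr, ← Real.rpow_mul hn0.le, hy]
          congr 2
          ring
      _ ≤ 3600 * y := by
          gcongr
          calc (60 : ℝ) ^ (2 - ε) ≤ 60 ^ (2 : ℝ) :=
                Real.rpow_le_rpow_of_exponent_le (by norm_num) (by linarith)
            _ = 3600 := by norm_num
  have hτ' : (τ : ℝ) ≤ 3600 * A * y := by
    refine hτ.trans ?_
    calc (A : ℝ) * ((28 * m + 2 : ℕ) : ℝ) ^ (2 - ε) ≤ A * (3600 * y) := by gcongr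
      _ = _ := by ring
  have hinner : (3 * (500 * m + R + 3 * τ + 230) + 50 : ℝ) ≤ D * y := by
    have hRy : (R : ℝ) ≤ R * y := le_mul_of_one_le_right (by positivity) hy1
    rw [hD]
    linarith
  set z : ℝ := (n : ℝ) ^ (2 - ε / 2) with hz
  have hnz : n * y = z := by
    rw [hz, hy]
    nth_rewrite 1 [← Real.rpow_one (n : ℝ)]
    rw [← Real.rpow_add hn0]
    congr 1
    ring
  have hz1 : 1 ≤ z := Real.one_le_rpow hn' (by linarith)
  have hD0 : 0 ≤ D := by positivity
  have hround : (m * m * (3 * (500 * m + R + 3 * τ + 230) + 50) + 1 : ℝ) ≤ (4 * D + 1) * z := by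
    calc (m * m * (3 * (500 * m + R + 3 * τ + 230) + 50) + 1 : ℝ) ≤ 4 * n * (D * y) + 1 :=
          add_le_add_left (mul_le_mul hmn' hinner (by positivity) (by positivity)) 1
      _ = 4 * D * z + 1 := by rw [← hnz]; ring
      _ ≤ _ := by linarith
  set w : ℝ := (n : ℝ) ^ (ε / 4) with hw
  have hw1 : 1 ≤ w := Real.one_le_rpow hn' (by positivity)
  have hrounds : (Nat.clog 2 (4 * M + 1) : ℝ) ≤ (4 + (2 * d + 1) * E) * w := by
    have h1 : Nat.clog 2 (4 * M + 1) ≤ 4 + Nat.clog 2 n * (2 * d + 1) := by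
      refine Nat.clog_le_of_le_pow (hM.trans ?_)
      rw [pow_add 2 4, pow_mul 2 (Nat.clog 2 n)]
      refine Nat.mul_le_mul (by norm_num) (Nat.pow_le_pow_left ?_ _)
      exact Nat.le_pow_clog (by norm_num) n
    have h2 : (Nat.clog 2 (4 * M + 1) : ℝ) ≤ 4 + Nat.clog 2 n * (2 * d + 1) := by
      exact_mod_cast h1
    have h3 : (Nat.clog 2 n : ℝ) * (2 * d + 1) ≤ E * w * (2 * d + 1) := by
      gcongr
      exact hclog n hn
    linarith
  set v : ℝ := (n : ℝ) ^ (2 - ε / 4) with hv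
  have hwz : w * z = v := by
    rw [hw, hz, ← Real.rpow_add hn0]
    congr 1
    ring
  have hnv : (n : ℝ) ≤ v := by
    calc (n : ℝ) = (n : ℝ) ^ (1 : ℝ) := (Real.rpow_one _).symm
      _ ≤ v := Real.rpow_le_rpow_of_exponent_le hn' (by linarith)
  have hmv : (m : ℝ) ≤ 2 * v := by
    have : r ≤ v := Real.rpow_le_rpow_of_exponent_le hn' (by linarith)
    linarith
  have hprod : (Nat.clog 2 (4 * M + 1) : ℝ) *
      (m * m * (3 * (500 * m + R + 3 * τ + 230) + 50) + 1) ≤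
      (4 + (2 * d + 1) * E) * (4 * D + 1) * v := by
    calc _ ≤ ((4 + (2 * d + 1) * E) * w) * ((4 * D + 1) * z) := by gcongr
      _ = _ := by rw [← hwz]; ring
  have hfin : (70 + (4 + (2 * d + 1) * E) * (4 * D + 1)) * v ≤ C * v := by gcongr
  push_cast
  linarith

namespace WordRAM

theorem Config.Bounded.mono {c : Config} {B B' : ℕ} (h : c.Bounded B) (hB : B ≤ B') :
    c.Bounded B' := by
  have : (B : ℤ) ≤ B' := by exact_mod_cast hB
  exact ⟨fun r => (h.1 r).trans this, fun x => (h.2 x).trans this⟩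

theorem Frag.Ensures.halts {F : Frag} {B T n : ℕ} {post : Store → Prop} {mem : ℤ → ℤ}
    (h : F.Ensures B T post ⟨(initial n mem).reg, mem⟩) :
    ∃ t ≤ T, Halted (F.code 0) ((step (F.code 0))^[t] (initial n mem)) ∧
      (∃ reg, post ⟨reg, ((step (F.code 0))^[t] (initial n mem)).mem⟩) ∧
      ∀ s ≤ t, ((step (F.code 0))^[s] (initial n mem)).Bounded B := by
  obtain ⟨s', t, ht, hp, -, hr⟩ := h
  obtain ⟨h1, h2⟩ := hr (F.code 0) 0 (hasCode_self _)
  change (step (F.code 0))^[t] (initial n mem) = _ at h1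
  refine ⟨t, ht, ?_, ⟨s'.reg, ?_⟩, h2⟩
  · rw [h1, Halted, F.length_code]
    simp [Store.at]
  · rw [h1]
    exact hp

theorem memOfList_append_ofFn {n : ℕ} (f g : Fin n → ℤ) :
    (∀ i : Fin n, memOfList (List.ofFn f ++ List.ofFn g) (i : ℕ) = f i) ∧
    (∀ i : Fin n, memOfList (List.ofFn f ++ List.ofFn g) (n + i : ℕ) = g i) ∧
    ∀ x : ℤ, x < 0 ∨ 2 * n ≤ x → memOfList (List.ofFn f ++ List.ofFn g) x = 0 := by
  refine ⟨fun i => ?_, fun i => ?_, fun x hx => ?_⟩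
  · simp [memOfList, List.getD_eq_getElem?_getD, List.getElem?_append]
  · have h0 : (0 : ℤ) ≤ (n : ℤ) + (i : ℕ) := by omega
    have h1 : ((n : ℤ) + (i : ℕ)).toNat = n + i := by omega
    simp [memOfList, List.getD_eq_getElem?_getD, h0, h1]
  · unfold memOfList
    split_ifs with h
    · rw [List.getD_eq_default]
      simp
      omega
    · rfl

theorem abs_memOfList_le {l : List ℤ} {X : ℤ} (hX : 0 ≤ X) (h : ∀ x ∈ l, |x| ≤ X) (z : ℤ) :
    |memOfList l z| ≤ X := by
  unfold memOfList
  split_ifs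
  · rw [List.getD_eq_getElem?_getD]
    rcases hz : l[z.toNat]? with _ | v
    · simpa using hX
    · simpa using h v (List.mem_of_getElem? hz)
  · simpa using hX

end WordRAM

open WordRAM

theorem exists_ceil_sqrt {n : ℕ} (hn : 1 ≤ n) :
    ∃ m, 1 ≤ m ∧ m ≤ n ∧ n ≤ m * m ∧ (m - 1) * (m - 1) < n ∧ m * m ≤ 4 * n := by
  have h1 := Nat.sqrt_le (n - 1)
  have h2 := Nat.lt_succ_sqrt (n - 1)
  have h3 := Nat.sqrt_le_self (n - 1)
  refine ⟨Nat.sqrt (n - 1) + 1, by omega, by omega, by simp only [Nat.succ_eq_add_one] at h2; omega,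
    by rw [Nat.add_sub_cancel]; omega, ?_⟩
  have h4 : (n - 1).sqrt * (n - 1).sqrt + 1 ≤ n := by omega
  nlinarith [sq_nonneg ((n - 1).sqrt - 1 : ℤ)]

theorem minPlusConvolution_solvable {ε : ℝ} (hε : 0 < ε) (hε1 : ε ≤ 1)
    (h : minBisectionOnPaths.SolvableInTime fun n => (n : ℝ) ^ (2 - ε)) :
    minPlusConvolution.SolvableInTime fun n => (n : ℝ) ^ (2 - ε / 4) := by
  obtain ⟨P, hP⟩ := h
  obtain ⟨R, hR⟩ := exists_regsBelow P
  refine ⟨(Frag.convolution P R).code 0, fun d => ?_⟩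
  obtain ⟨A, k, hA⟩ := hP (4 * d + 4)
  obtain ⟨C, hC⟩ := exists_time_bound hε hε1 A R d
  refine ⟨C + (A * 30 ^ k + 260) * 43, k + 2 * d + 4, fun n hn I hI => ?_⟩
  obtain ⟨m, hm1, hmn, hnm, hm', hm4⟩ := exists_ceil_sqrt hn
  set mem := memOfList (minPlusConvolution.encode I) with hmem
  have habs : ∀ z, |mem z| ≤ (n : ℤ) ^ d := abs_memOfList_le (by positivity) hI
  obtain ⟨hmem_a, hmem_b, hmem_zero⟩ := memOfList_append_ofFn I.1 I.2
  change ∀ i : Fin n, mem (i : ℕ) = I.1 i at hmem_a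
  change ∀ i : Fin n, mem (n + i : ℕ) = I.2 i at hmem_b
  change ∀ x : ℤ, x < 0 ∨ 2 * n ≤ x → mem x = 0 at hmem_zero
  have hsum : 0 ≤ ∑ i ∈ Finset.range (2 * n), mem i * mem i :=
    Finset.sum_nonneg fun i _ => mul_self_nonneg _
  obtain ⟨M, hM⟩ : ∃ M : ℕ, (M : ℤ) = 1 + ∑ i ∈ Finset.range (2 * n), mem i * mem i :=
    ⟨(1 + ∑ i ∈ Finset.range (2 * n), mem i * mem i).toNat, Int.toNat_of_nonneg (by omega)⟩
  have hM1 : 1 ≤ M := by omega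
  have hMn : M ≤ 3 * n ^ (2 * d + 1) := by
    have h1 : ∑ i ∈ Finset.range (2 * n), mem i * mem i ≤
        ∑ _i ∈ Finset.range (2 * n), (n : ℤ) ^ (2 * d) := by
      refine Finset.sum_le_sum fun i _ => ?_
      rw [← abs_mul_abs_self, two_mul, pow_add]
      exact mul_le_mul (habs _) (habs _) (abs_nonneg _) (by positivity)
    rw [Finset.sum_const, Finset.card_range, nsmul_eq_mul] at h1
    have h2 : 1 ≤ n ^ (2 * d + 1) := Nat.one_le_pow _ _ hn
    zify at h2 ⊢
    rw [pow_succ] at h2 ⊢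
    push_cast at h1
    linarith
  have hmemM : ∀ z, |mem z| ≤ M := by
    intro z
    by_cases hz : 0 ≤ z ∧ z < 2 * n
    · obtain ⟨i, rfl⟩ := Int.eq_ofNat_of_zero_le hz.1
      have h1 := Finset.single_le_sum (f := fun i : ℕ => mem i * mem i)
        (fun i _ => mul_self_nonneg _) (Finset.mem_range.2 (show i < 2 * n by omega))
      replace h1 : mem i * mem i ≤ M := h1.trans (by omega)
      rw [← abs_mul_abs_self] at h1
      nlinarith [abs_nonneg (mem i)]
    · rw [hmem_zero z (by omega)]
      simp
  let p : Params := ⟨n, m, M, n + 3 * (m * m) + 3 * (m * m) * (4 * M + 1), hm1, hM1, rfl⟩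
  have hS : p.S ≤ 43 * n ^ (2 * d + 3) := by
    have h1 : m * m ≤ n * n := Nat.mul_le_mul hmn hmn
    have h2 : n ≤ n * n := Nat.le_mul_self n
    have h3 : 1 ≤ n ^ (2 * d + 1) := Nat.one_le_pow _ _ hn
    calc p.S = n + 3 * (m * m) + 3 * (m * m) * (4 * M + 1) := rfl
      _ ≤ n * n + 3 * (n * n) + 3 * (n * n) * (4 * (3 * n ^ (2 * d + 1)) + 1) := by gcongr
      _ = n * n * (7 + 36 * n ^ (2 * d + 1)) := by ring
      _ ≤ n * n * (43 * n ^ (2 * d + 1)) := by gcongr; omega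
      _ = _ := by ring
  set N := 28 * m + 2 with hN
  set b₀ := A * N ^ k with hb₀
  set B := (b₀ + 60 * m + 200) * p.S with hB
  have hBn : B ≤ (A * 30 ^ k + 260) * 43 * n ^ (k + 2 * d + 4) := by
    have h1 : b₀ ≤ A * (30 * n) ^ k := by rw [hb₀]; gcongr; omega
    have h2 : n ≤ n ^ (k + 1) := Nat.le_self_pow (by omega) n
    have h3 : n ^ k ≤ n ^ (k + 1) := Nat.pow_le_pow_right hn (by omega)
    calc B ≤ (A * (30 * n) ^ k + 60 * n + 200 * n) * (43 * n ^ (2 * d + 3)) := by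
          rw [hB]; gcongr; omega
      _ = (A * 30 ^ k * n ^ k + 260 * n) * (43 * n ^ (2 * d + 3)) := by rw [mul_pow]; ring
      _ ≤ (A * 30 ^ k * n ^ (k + 1) + 260 * n ^ (k + 1)) * (43 * n ^ (2 * d + 3)) := by gcongr
      _ = _ := by ring
  set τ := ⌊(A : ℝ) * (N : ℝ) ^ (2 - ε)⌋₊ with hτ
  have hsolve : SolvesPaths P (28 * p.m + 2) τ b₀ (4 * (32 * p.M + 32)) := by
    intro J hJ
    obtain ⟨t, ht, h1, h2, h3⟩ := hA N (by omega) J fun x hx => by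
      refine (hJ x hx).trans ?_
      have h1 : 4 * (32 * M + 32) ≤ N ^ (4 * d + 4) := by
        calc 4 * (32 * M + 32) ≤ 256 * M := by omega
          _ ≤ 256 * (3 * (N * N) ^ (2 * d + 1)) := by
              gcongr
              refine hMn.trans ?_
              gcongr
              refine hnm.trans ?_
              gcongr <;> omega
          _ ≤ 30 * 30 * (N * N) ^ (2 * d + 1) := by
              rw [← mul_assoc]; exact Nat.mul_le_mul_right _ (by norm_num)
          _ ≤ N * N * (N * N) ^ (2 * d + 1) := by gcongr <;> omega
          _ = _ := by rw [← pow_succ', ← sq, ← pow_mul]; congr 1; ring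
      exact_mod_cast h1
    exact ⟨t, Nat.le_floor ht, h1, h2, h3⟩
  have hbounds : Bounds p b₀ B (fun i => mem i) (fun i => mem (n + i : ℕ)) :=
    ⟨le_rfl, fun i _ => hmemM i, fun i _ => hmemM (n + i : ℕ)⟩
  have hlin := hbounds.linear
  obtain ⟨hS₁, -, -⟩ := p.le_S
  have hstore : (⟨(initial n mem).reg, mem⟩ : Store).Bounded B := by
    have hn_le : n ≤ p.S := by change p.n ≤ p.S; omega
    have hM_le : M ≤ p.S := by change p.M ≤ p.S; omega
    refine ⟨fun r => ?_, fun x => (hmemM x).trans (by omega)⟩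
    simp only [initial]
    split_ifs
    · rw [abs_of_nonneg (by omega)]
      omega
    · simp
  have hmain := Frag.Ensures.convolution (p := p) hR hsolve hbounds hstore rfl hnm hm' hM
    (fun i _ => rfl) (fun i _ => rfl) hmem_zero
  obtain ⟨t, ht, hhalt, ⟨reg, hpost⟩, hbd⟩ := hmain.halts
  refine ⟨t, ?_, hhalt, fun l => ?_, fun s hs => (hbd s hs).mono (hBn.trans ?_)⟩
  · have h1 := hC n m M τ hn hm1 hm4 (by omega) (Nat.floor_le (by positivity))
    refine le_trans (Nat.cast_le.2 ht) (h1.trans ?_)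
    push_cast
    gcongr
    have : (0 : ℝ) ≤ (A * 30 ^ k + 260) * 43 := by positivity
    linarith
  · obtain ⟨h1, i, j, hij, h2⟩ := hpost l l.2
    refine ⟨⟨⟨i, by omega⟩, ⟨j, by omega⟩, hij, ?_⟩, ?_⟩
    · rw [← hmem_a, ← hmem_b]
      exact h2
    · rintro x ⟨i', j', hij', rfl⟩
      rw [← hmem_a, ← hmem_b]
      exact h1 i' j' hij'
  · gcongr
    omega

theorem mainTheorem2
    (hconv : ¬ ∃ δ : ℝ, 0 < δ ∧
      minPlusConvolution.SolvableInTime fun n => (n : ℝ) ^ (2 - δ)) :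
    ∀ ε : ℝ, 0 < ε →
      ¬ minBisectionOnPaths.SolvableInTime fun n => (n : ℝ) ^ (2 - ε) := by
  intro ε hε h
  have hε' : 0 < min ε 1 := lt_min hε one_pos
  refine hconv ⟨min ε 1 / 4, by positivity,
    minPlusConvolution_solvable hε' (min_le_right _ _) ?_⟩
  obtain ⟨P, hP⟩ := h
  refine ⟨P, fun d => ?_⟩
  obtain ⟨C, k, hC⟩ := hP d
  refine ⟨C, k, fun n hn I hI => ?_⟩
  obtain ⟨t, ht, h'⟩ := hC n hn I hI
  refine ⟨t, ht.trans ?_, h'⟩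
  have hn' : (1 : ℝ) ≤ n := by exact_mod_cast hn
  exact mul_le_mul_of_nonneg_left
    (Real.rpow_le_rpow_of_exponent_le hn' (by linarith [min_le_left ε 1])) (by positivity)
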